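/- Conventions. For a tempered distribution $f$ on $\mathbb{R}^d$ whose Fourier transform $\hat f$ (normalised by $\hat f(\xi)=\int f(x)e^{-2\pi i x\cdot\xi}\,dx$) is a function, put $$\|f\|_{\mathscr{B}^1}=\int_{\mathbb{R}^d}(1+|\xi|_1)\,|\hat f(\xi)|\,d\xi,\qquad \|f\|_{\mathscr{B}^{1,\log}}=\int_{\mathbb{R}^d}(1+|\xi|_1)\log_2(2+|\xi|_1)\,|\hat f(\xi)|\,d\xi,$$ where $|\xi|_1=\sum_i|\xi_i|$; both norms are $\infty$ if $\hat f$ is not a function. Let $\mathscr{B}^{1,\log}$ be the set of tempered distributions $f$ with $\|f\|_{\mathscr{B}^{1,\log}}<\infty$. A ReLU network of width $N$ and depth $L\ge 1$ is a function $F:\mathbb{R}^d\to\mathbb{R}$ of the form $F(x)=c\cdot z_L$ with $z_0=x$, $z_l=\mathrm{ReLU}(W_l z_{l-1}+b_l)$ for $1\le l\le L$, where $W_1\in\mathbb{R}^{N\times d}$, $W_l\in\mathbb{R}^{N\times N}$ for $l\ge2$, $b_l,c\in\mathbb{R}^N$, and $\mathrm{ReLU}(t)=\max(0,t)$ is applied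 coordinatewise. For a weakly differentiable $u:\mathbb{R}^d\to\mathbb{R}$ and a measurable set $\Omega$, $\|u\|_{H^1(\Omega)}^2=\|u\|_{L^2(\Omega)}^2+\sum_{j=1}^d\|D_ju\|_{L^2(\Omega)}^2$, where $D_ju$ is the weak derivative on $\mathbb{R}^d$. $|\Omega|$ is the Lebesgue measure. Theorem. Let $f\in\mathscr{B}^{1,\log}$ be real. Then $f$ is given by a continuous function $\mathbb{R}^d\to\mathbb{R}$, and for every integer $m\ge1$ and every compact set $\Omega\subset[0,1]^d$ there exist ReLU networks $F_1,\dots,F_m$ of width $3$ and depths $L_1,\dots,L_m$ such that $$\Big\|f-\frac1m\sum_{i=1}^mF_i\Big\|_{H^1(\Omega)}^2\le\frac{11\pi^4}{m}\,|\Omega|\,\|f\|_{\mathscr{B}^1}^2$$ and, if $f\ne0$, $$\sum_{i=1}^mL_i\le 5m\,\frac{\|f\|_{\mathscr{B}^{1,\log}}}{\|f\|_{\mathscr{B}^1}}.$$ -/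

import Mathlib

open MeasureTheory
open scoped SchwartzMap FourierTransform ENNReal ContDiff

noncomputable section

namespace LogBarron

/-- `ℝ^d` with its Euclidean structure and Lebesgue measure. -/
abbrev Space (d : ℕ) : Type := EuclideanSpace ℝ (Fin d)

/-- The `1`-norm `|ξ|₁ = ∑ |ξ_i|`. -/
def norm1 {d : ℕ} (ξ : Space d) : ℝ := ∑ i, |ξ i|

/-- The tempered distribution `T` is (given by integration against) the function `h`. -/
def IsRepresentedBy {d : ℕ} (T : 𝓢'(Space d, ℂ)) (h : Space d → ℂ) : Prop :=
  LocallyIntegrable h volume ∧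
    ∀ φ : 𝓢(Space d, ℂ), Integrable (fun x => φ x * h x) volume ∧ T φ = ∫ x, φ x * h x

/-- The tempered distribution `T` is real: it takes real values on real test functions. -/
def IsReal {d : ℕ} (T : 𝓢'(Space d, ℂ)) : Prop :=
  ∀ φ : 𝓢(Space d, ℂ), (∀ x, (φ x).im = 0) → (T φ).im = 0

/-- `∫ w(ξ) |T^(ξ)| dξ`, where `T^` is the Fourier transform of the tempered distribution `T`
(normalised by `e^{-2πi x·ξ}`); it is `∞` if `T^` is not a function.
The function `h` that represents `T^` is unique up to a null set. -/
def fourierWeightNorm {d : ℕ} (w : Space d → ℝ) (T : 𝓢'(Space d, ℂ)) : ℝ≥0∞ :=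
  ⨅ (h : Space d → ℂ) (_ : IsRepresentedBy (𝓕 T) h),
    ∫⁻ ξ, ENNReal.ofReal (w ξ) * ‖h ξ‖ₑ

/-- The norm of the Barron space `B^s`. -/
def barronNorm {d : ℕ} (s : ℝ) (T : 𝓢'(Space d, ℂ)) : ℝ≥0∞ :=
  fourierWeightNorm (fun ξ => 1 + norm1 ξ ^ s) T

/-- The norm of the log-Barron space `B^{s,log}`. -/
def logBarronNorm {d : ℕ} (s : ℝ) (T : 𝓢'(Space d, ℂ)) : ℝ≥0∞ :=
  fourierWeightNorm (fun ξ => (1 + norm1 ξ ^ s) * Real.logb 2 (2 + norm1 ξ)) T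

/-- The log-Barron space `B^{s,log}`. -/
def logBarronSpace (d : ℕ) (s : ℝ) : Set 𝓢'(Space d, ℂ) :=
  {T | logBarronNorm s T < ⊤}

/-- `g` is the weak partial derivative `D_j u` on `ℝ^d`. -/
def HasWeakPartialDeriv {d : ℕ} (j : Fin d) (u g : Space d → ℝ) : Prop :=
  LocallyIntegrable u volume ∧ LocallyIntegrable g volume ∧
    ∀ φ : Space d → ℝ, ContDiff ℝ ∞ φ → HasCompactSupport φ →
      ∫ x, u x * fderiv ℝ φ x (EuclideanSpace.single j 1) = - ∫ x, g x * φ x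

/-- The squared norm `‖u‖²_{H¹(Ω)} = ‖u‖²_{L²(Ω)} + ∑_j ‖D_j u‖²_{L²(Ω)}` of a function `u` on
`ℝ^d`, with the weak derivatives `D_j u` taken on `ℝ^d` (unique up to null sets);
it is `∞` if `u` is not weakly differentiable. -/
def h1NormSq {d : ℕ} (Ω : Set (Space d)) (u : Space d → ℝ) : ℝ≥0∞ :=
  ⨅ (g : Fin d → Space d → ℝ) (_ : ∀ j, HasWeakPartialDeriv j u (g j)),
    (∫⁻ x in Ω, ‖u x‖ₑ ^ 2) + ∑ j, ∫⁻ x in Ω, ‖g j x‖ₑ ^ 2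

/-- One layer `z ↦ ReLU(W z + b)`, with `ReLU(t) = max(0, t)` in each coordinate. -/
def reluLayer {n N : ℕ} (W : Matrix (Fin N) (Fin n) ℝ) (b : Fin N → ℝ) (z : Fin n → ℝ) :
    Fin N → ℝ :=
  fun i => max 0 (W.mulVec z i + b i)

/-- The output of the hidden layer with index `l`, counted from `0`. -/
def hiddenLayer {n N : ℕ} (W₀ : Matrix (Fin N) (Fin n) ℝ) (W : ℕ → Matrix (Fin N) (Fin N) ℝ)
    (b : ℕ → Fin N → ℝ) (x : Fin n → ℝ) : ℕ → Fin N → ℝ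
  | 0 => reluLayer W₀ (b 0) x
  | l + 1 => reluLayer (W l) (b (l + 1)) (hiddenLayer W₀ W b x l)

/-- `F : ℝ^d → ℝ` is a ReLU network of width `N` and depth `L`: it has `L ≥ 1` hidden layers with
`N` nodes each, followed by a linear output map (without bias). -/
def IsReLUNetwork {d : ℕ} (N L : ℕ) (F : Space d → ℝ) : Prop :=
  1 ≤ L ∧ ∃ (W₀ : Matrix (Fin N) (Fin d) ℝ) (W : ℕ → Matrix (Fin N) (Fin N) ℝ)
    (b : ℕ → Fin N → ℝ) (c : Fin N → ℝ),
    ∀ x : Space d, F x = ∑ i, c i * hiddenLayer W₀ W b (fun j => x j) (L - 1) i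

end LogBarron

end

namespace LogBarron

/-! Let `h` be the Fourier transform of `f` and `B` the Barron norm. Fourier inversion and realness
give `f x = ∫ ‖h ξ‖ cos (2π(ξ·x + τ ξ)) dξ` with `τ = arg h / 2π`. Under the probability measure
proportional to `(1 + |ξ|₁) ‖h ξ‖` this is the expectation of `A ξ * cos (2π(ξ·x + τ ξ))` with
amplitude `A ξ = B / (1 + |ξ|₁)`, which compensates the size of the gradient.

A cosine is not piecewise linear, but it is an average of piecewise linear waves: `cos (2πt)` is the
mean of `wave b t` when `b` has density `sin b` on `(0, π/2]` (`integral_wave_mul_sin`). So `f` is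
the mean, over random `(ξ, b)`, of the functions `A ξ * wave b (ξ·x + τ ξ)`. On the cube each of
these equals exactly a width-3 network of depth at most `4 log₂ (2 + |ξ|₁)`, because about `log₂
|ξ|₁` folds bring the phase into a half period (`exists_network_on_cube`).

Value and gradient of every sample together have Euclidean norm at most `2πB` (`sum_ridge_sq_le`),
so averaging `m` samples gives a mean squared `H¹` error of at most `C / m` with `C = (2πB)² |Ω|`.
To control depth at the same time, `exists_samples` adds to the squared error a depth cost weighted
to have mean `4C` per sample. The total is at most `5Cm`, and each of the two summands inherits a
bound. The expected value of `log₂ (2 + |ξ|₁)` is the ratio of the two norms, and `20π² ≤ 11π⁴`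
gives the stated constant.

Kinks do no harm: for fixed `x` a random `b` almost surely avoids them, so the mean may be
differentiated under the integral (`hasLineDerivAt_integral_ridge`). -/

/-! ### Truncated triangle waves -/

/-- The triangle wave `arcsin (cos (2πt))`, truncated to `[-|b|, |b|]`. -/
noncomputable def wave (b t : ℝ) : ℝ :=
  max (-|b|) (min |b| (Real.arcsin (Real.cos (2 * Real.pi * t))))

lemma abs_arcsin_le (x : ℝ) : |Real.arcsin x| ≤ Real.pi / 2 :=
  abs_le.2 ⟨Real.neg_pi_div_two_le_arcsin x, Real.arcsin_le_pi_div_two x⟩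

lemma abs_max_neg_min_le (b z : ℝ) : |max (-|b|) (min |b| z)| ≤ |z| := by
  have hb := abs_nonneg b
  rcases le_total 0 z with hz | hz
  · rw [abs_of_nonneg hz, max_eq_right (by linarith [le_min hb hz]),
      abs_of_nonneg (le_min hb hz)]
    exact min_le_right _ _
  · rw [abs_of_nonpos hz, min_eq_right (hz.trans hb),
      abs_of_nonpos (max_le (by linarith) hz)]
    linarith [le_max_right (-|b|) z]

lemma abs_wave_le (b t : ℝ) : |wave b t| ≤ Real.pi / 2 :=
  (abs_max_neg_min_le _ _).trans (abs_arcsin_le _)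

lemma continuous_wave : Continuous (Function.uncurry wave) := by
  unfold wave Function.uncurry
  have := Real.continuous_arcsin
  fun_prop

/-- Both sides are the distance from `x` to `2πℤ`. As a quotient norm this is visibly 1-Lipschitz,
although `arccos` itself is not Lipschitz. -/
lemma arccos_cos_eq_norm (x : ℝ) :
    Real.arccos (Real.cos x) = ‖(x : AddCircle (2 * Real.pi))‖ := by
  have hp : (0 : ℝ) < 2 * Real.pi := by positivity
  set n : ℤ := round ((2 * Real.pi)⁻¹ * x) with hn
  have h1 : ‖(x : AddCircle (2 * Real.pi))‖ = |x - n * (2 * Real.pi)| := by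
    rw [AddCircle.norm_eq]
  have h2 : ‖(x : AddCircle (2 * Real.pi))‖ ≤ Real.pi := by
    have := AddCircle.norm_le_half_period (2 * Real.pi) (x := (x : AddCircle (2 * Real.pi)))
      hp.ne'
    rw [abs_of_pos hp] at this
    linarith
  rw [h1] at h2 ⊢
  rw [← Real.cos_sub_int_mul_two_pi x n, ← Real.cos_abs, Real.arccos_cos (abs_nonneg _) h2]

lemma lipschitzWith_arccos_cos : LipschitzWith 1 (fun x => Real.arccos (Real.cos x)) := by
  refine LipschitzWith.of_dist_le_mul fun x y => ?_
  simp only [arccos_cos_eq_norm, NNReal.coe_one, one_mul, Real.dist_eq]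
  refine (abs_norm_sub_norm_le _ _).trans ?_
  rw [← AddCircle.coe_sub]
  exact QuotientAddGroup.norm_mk_le_norm

lemma lipschitzWith_wave (b : ℝ) :
    LipschitzWith (2 * Real.pi).toNNReal (wave b) := by
  refine LipschitzWith.of_dist_le_mul fun x y => ?_
  rw [Real.coe_toNNReal _ (by positivity), Real.dist_eq, Real.dist_eq]
  have h := lipschitzWith_arccos_cos.dist_le_mul (2 * Real.pi * x) (2 * Real.pi * y)
  rw [NNReal.coe_one, one_mul, Real.dist_eq, Real.dist_eq, ← mul_sub, abs_mul,
    abs_of_pos (by positivity : 0 < 2 * Real.pi)] at h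
  refine le_trans ?_ h
  unfold wave
  rw [Real.arccos_eq_pi_div_two_sub_arcsin, Real.arccos_eq_pi_div_two_sub_arcsin]
  rw [max_comm, max_comm (-|b|)]
  refine (abs_max_sub_max_le_abs _ _ _).trans ?_
  refine (abs_min_sub_min_le_max _ _ _ _).trans ?_
  rw [sub_self, abs_zero, max_eq_right (abs_nonneg _)]
  rw [abs_sub_comm]
  apply le_of_eq
  congr 1
  ring

lemma abs_deriv_wave_le (b t : ℝ) : |deriv (wave b) t| ≤ 2 * Real.pi := by
  have := norm_deriv_le_of_lipschitz (lipschitzWith_wave b) (x₀ := t)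
  rwa [Real.coe_toNNReal _ (by positivity), Real.norm_eq_abs] at this

/-- The truncation cuts off the corners of the triangle wave, which sit at height `±π/2`, so the
only kinks left are at height `±b`. -/
lemma differentiableAt_wave {b t : ℝ} (hb : b < Real.pi / 2) (h0 : 0 < b)
    (hne : |Real.arcsin (Real.cos (2 * Real.pi * t))| ≠ b) : DifferentiableAt ℝ (wave b) t := by
  have hc : Continuous fun t => |Real.arcsin (Real.cos (2 * Real.pi * t))| := by
    have := Real.continuous_arcsin
    fun_prop
  rcases lt_or_gt_of_ne hne with h | h
  · have hev : wave b =ᶠ[nhds t] fun t => Real.arcsin (Real.cos (2 * Real.pi * t)) := by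
      filter_upwards [hc.continuousAt.eventually (gt_mem_nhds h)] with s hs
      have := abs_lt.1 hs
      unfold wave
      rw [abs_of_pos h0, min_eq_right this.2.le, max_eq_right this.1.le]
    refine DifferentiableAt.congr_of_eventuallyEq ?_ hev
    have h1 : Real.cos (2 * Real.pi * t) ≠ -1 := by
      intro h1
      rw [h1, Real.arcsin_neg_one, abs_neg, abs_of_pos (by positivity)] at h
      linarith
    have h2 : Real.cos (2 * Real.pi * t) ≠ 1 := by
      intro h1
      rw [h1, Real.arcsin_one, abs_of_pos (by positivity)] at h
      linarith
    exact DifferentiableAt.fun_comp' (g := Real.arcsin) t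
      (Real.differentiableAt_arcsin.2 ⟨h1, h2⟩) (by fun_prop)
  · have hc' : Continuous fun t => Real.arcsin (Real.cos (2 * Real.pi * t)) := by
      have := Real.continuous_arcsin
      fun_prop
    rcases lt_abs.1 h with h | h
    · have hev : wave b =ᶠ[nhds t] fun t => b := by
        filter_upwards [hc'.continuousAt.eventually (lt_mem_nhds h)] with s hs
        unfold wave
        rw [abs_of_pos h0, min_eq_left hs.le, max_eq_right (by linarith)]
      exact DifferentiableAt.congr_of_eventuallyEq (differentiableAt_const _) hev
    · have hev : wave b =ᶠ[nhds t] fun t => -b := by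
        filter_upwards [hc'.continuousAt.eventually (gt_mem_nhds (lt_neg.1 h))] with s hs
        unfold wave
        rw [abs_of_pos h0, min_eq_right (by linarith), max_eq_left hs.le]
      exact DifferentiableAt.congr_of_eventuallyEq (differentiableAt_const _) hev

/-! ### The cosine as an average of truncated waves -/

lemma integral_mul_sin (z : ℝ) :
    ∫ b in (0 : ℝ)..z, b * Real.sin b = Real.sin z - z * Real.cos z := by
  have h : ∀ x ∈ Set.uIcc 0 z, HasDerivAt (fun b => Real.sin b - b * Real.cos b)
      (x * Real.sin x) x := fun x _ => by
    refine ((Real.hasDerivAt_sin x).sub ((hasDerivAt_id x).mul (Real.hasDerivAt_cos x))).congr_deriv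
      ?_
    simp
  rw [intervalIntegral.integral_eq_sub_of_hasDerivAt h
    (Continuous.intervalIntegrable (by fun_prop) _ _)]
  simp

/-- `min b z` is the Green's function of `-d²/dz²` on `[0, π/2]` with value zero at `0` and slope
zero at `π/2`; the sine satisfies `-sin'' = sin` and both boundary conditions. -/
lemma integral_min_mul_sin {z : ℝ} (h0 : 0 ≤ z) (h1 : z ≤ Real.pi / 2) :
    ∫ b in (0 : ℝ)..(Real.pi / 2), min b z * Real.sin b = Real.sin z := by
  have hc : Continuous fun b => min b z * Real.sin b := by fun_prop
  rw [← intervalIntegral.integral_add_adjacent_intervals (b := z)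
    (hc.intervalIntegrable _ _) (hc.intervalIntegrable _ _)]
  have e1 : ∫ b in (0 : ℝ)..z, min b z * Real.sin b = ∫ b in (0 : ℝ)..z, b * Real.sin b := by
    refine intervalIntegral.integral_congr fun b hb => ?_
    rw [Set.uIcc_of_le h0] at hb
    simp only [min_eq_left hb.2]
  have e2 : ∫ b in z..(Real.pi / 2), min b z * Real.sin b
      = ∫ b in z..(Real.pi / 2), z * Real.sin b := by
    refine intervalIntegral.integral_congr fun b hb => ?_
    rw [Set.uIcc_of_le h1] at hb
    simp only [min_eq_right hb.1]
  rw [e1, e2, integral_mul_sin, intervalIntegral.integral_const_mul, integral_sin]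
  simp

lemma integral_wave_mul_sin (t : ℝ) :
    ∫ b in (0 : ℝ)..(Real.pi / 2), wave b t * Real.sin b = Real.cos (2 * Real.pi * t) := by
  set z := Real.arcsin (Real.cos (2 * Real.pi * t)) with hz
  have hsin : Real.sin z = Real.cos (2 * Real.pi * t) :=
    Real.sin_arcsin (Real.neg_one_le_cos _) (Real.cos_le_one _)
  have hpi : (0 : ℝ) ≤ Real.pi / 2 := by positivity
  obtain ⟨l, u⟩ := abs_le.1 (abs_arcsin_le (Real.cos (2 * Real.pi * t)))
  rw [← hz] at l u
  rw [← hsin]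
  rcases le_total 0 z with h | h
  · rw [← integral_min_mul_sin h u]
    refine intervalIntegral.integral_congr fun b hb => ?_
    rw [Set.uIcc_of_le hpi] at hb
    simp only [wave, ← hz]
    rw [abs_of_nonneg hb.1, max_eq_right (by linarith [le_min hb.1 h, hb.1])]
  · have := integral_min_mul_sin (z := -z) (by linarith) (by linarith)
    rw [Real.sin_neg] at this
    rw [← neg_eq_iff_eq_neg.2 this, ← intervalIntegral.integral_neg]
    refine intervalIntegral.integral_congr fun b hb => ?_
    rw [Set.uIcc_of_le hpi] at hb
    simp only [wave, ← hz]
    rw [abs_of_nonneg hb.1, min_eq_right (by linarith [hb.1] : z ≤ b), ← neg_mul,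
      ← max_neg_neg, neg_neg]

lemma arcsin_cos_of_mem {u : ℝ} (h0 : 0 ≤ u) (h1 : u ≤ 1 / 2) :
    Real.arcsin (Real.cos (2 * Real.pi * u)) = Real.pi / 2 - 2 * Real.pi * u := by
  have hpi := Real.pi_pos
  rw [Real.arcsin_eq_pi_div_two_sub_arccos, Real.arccos_cos (by positivity) (by nlinarith)]

/-- On a half period the truncated wave is a combination of two ReLU functions and a constant. -/
lemma wave_eq_relu (b : ℝ) {u t : ℝ} (h0 : 0 ≤ u) (h1 : u ≤ 1 / 2)
    (hcos : Real.cos (2 * Real.pi * u) = Real.cos (2 * Real.pi * t)) :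
    wave b t = |b| - max 0 (2 * Real.pi * u - (Real.pi / 2 - |b|))
      + max 0 (2 * Real.pi * u - (Real.pi / 2 + |b|)) := by
  unfold wave
  rw [← hcos, arcsin_cos_of_mem h0 h1]
  have hb := abs_nonneg b
  rcases max_cases 0 (2 * Real.pi * u - (Real.pi / 2 - |b|)) with ⟨e1, _⟩ | ⟨e1, _⟩ <;>
  rcases max_cases 0 (2 * Real.pi * u - (Real.pi / 2 + |b|)) with ⟨e2, _⟩ | ⟨e2, _⟩ <;>
  rcases min_cases |b| (Real.pi / 2 - 2 * Real.pi * u) with ⟨e3, _⟩ | ⟨e3, _⟩ <;>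
  rw [e1, e2, e3] <;>
  rcases max_cases (-|b|) |b| with ⟨e4, _⟩ | ⟨e4, _⟩ <;>
  rcases max_cases (-|b|) (Real.pi / 2 - 2 * Real.pi * u) with ⟨e5, _⟩ | ⟨e5, _⟩ <;>
  simp only [e4, e5] <;> linarith

/-! ### ReLU networks -/

lemma exists_lipschitzWith_affine {α ι : Type*} [PseudoMetricSpace α] [Fintype ι]
    {g : ι → α → ℝ} (hg : ∀ i, ∃ K, LipschitzWith K (g i)) (c : ι → ℝ) (b : ℝ) :
    ∃ K, LipschitzWith K fun x => ∑ i, c i * g i x + b := by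
  choose K hK using hg
  refine ⟨∑ i, ‖c i‖₊ * K i, LipschitzWith.of_dist_le_mul fun x y => ?_⟩
  rw [Real.dist_eq, add_sub_add_right_eq_sub, ← Finset.sum_sub_distrib]
  push_cast
  rw [Finset.sum_mul]
  refine (Finset.abs_sum_le_sum_abs _ _).trans (Finset.sum_le_sum fun i _ => ?_)
  rw [← mul_sub, abs_mul, mul_assoc]
  exact mul_le_mul_of_nonneg_left ((hK i).dist_le_mul x y) (abs_nonneg _)

lemma exists_lipschitzWith_reluLayer {α : Type*} [PseudoMetricSpace α] {n N : ℕ}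
    {z : α → Fin n → ℝ} (hz : ∀ i, ∃ K, LipschitzWith K fun x => z x i)
    (W : Matrix (Fin N) (Fin n) ℝ) (b : Fin N → ℝ) (i : Fin N) :
    ∃ K, LipschitzWith K fun x => reluLayer W b (z x) i := by
  obtain ⟨K, hK⟩ := exists_lipschitzWith_affine hz (W i) (b i)
  exact ⟨K, hK.const_max 0⟩

/-- Weak derivatives are taken on all of `ℝ^d`, whereas the networks are identified only on the
cube; a global Lipschitz bound provides the derivatives. -/
lemma IsReLUNetwork.exists_lipschitzWith {d N L : ℕ} {F : Space d → ℝ}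
    (hF : IsReLUNetwork N L F) : ∃ K, LipschitzWith K F := by
  obtain ⟨-, W₀, W, b, c, h⟩ := hF
  have key : ∀ l i, ∃ K, LipschitzWith K
      fun x : Space d => hiddenLayer W₀ W b (fun j => x j) l i := by
    intro l
    induction l with
    | zero =>
      refine exists_lipschitzWith_reluLayer (fun i => ⟨1, ?_⟩) _ _
      refine LipschitzWith.of_dist_le_mul fun x y => ?_
      rw [NNReal.coe_one, one_mul, Real.dist_eq, dist_eq_norm]
      exact PiLp.norm_apply_le (x - y) i
    | succ l ih => exact exists_lipschitzWith_reluLayer ih _ _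
  obtain ⟨K, hK⟩ := exists_lipschitzWith_affine (key (L - 1)) c 0
  refine ⟨K, ?_⟩
  have : F = fun x => ∑ i, c i * hiddenLayer W₀ W b (fun j => x j) (L - 1) i + 0 := by
    funext x
    rw [h, add_zero]
  rwa [this]

/-- Repeated folding of `|t|` at `2^k/4, 2^k/8, …`. -/
noncomputable def foldSeq (k : ℕ) (t : ℝ) : ℕ → ℝ
  | 0 => |t|
  | l + 1 => foldSeq k t l - 2 * max 0 (foldSeq k t l - 2 ^ k / 2 ^ (l + 2))

/-- Each fold reflects the upper half of `[0, 2^k/2^(l+1)]` onto the lower half. The reflection is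
`v ↦ 2^k/2^(l+1) - v`, and this constant is an integer as long as `l + 1 ≤ k`, so the cosine does
not change. -/
lemma foldSeq_spec {k : ℕ} {t : ℝ} (ht : |t| ≤ 2 ^ k / 2) {l : ℕ} (hl : l ≤ k) :
    0 ≤ foldSeq k t l ∧ foldSeq k t l ≤ 2 ^ k / 2 ^ (l + 1) ∧
      Real.cos (2 * Real.pi * foldSeq k t l) = Real.cos (2 * Real.pi * t) := by
  induction l with
  | zero =>
    refine ⟨abs_nonneg _, by simpa [foldSeq] using ht, ?_⟩
    rw [foldSeq, ← Real.cos_abs (2 * Real.pi * t), abs_mul,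
      abs_of_pos (by positivity : 0 < 2 * Real.pi)]
  | succ l ih =>
    obtain ⟨h0, h1, h2⟩ := ih (by omega)
    have e : (2 : ℝ) ^ k / 2 ^ (l + 1) = 2 * (2 ^ k / 2 ^ (l + 2)) := by
      rw [pow_succ _ (l + 1)]; field_simp
    have e' : (2 : ℝ) ^ k / 2 ^ (l + 1) = ((2 ^ (k - (l + 1)) : ℕ) : ℝ) := by
      rw [div_eq_iff (by positivity)]
      push_cast
      rw [← pow_add]
      congr 1
      omega
    rw [foldSeq]
    rcases max_cases 0 (foldSeq k t l - 2 ^ k / 2 ^ (l + 2)) with ⟨h, h'⟩ | ⟨h, h'⟩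
    · rw [h, mul_zero, sub_zero]
      exact ⟨h0, by linarith, h2⟩
    · rw [h]
      refine ⟨by linarith, by linarith, ?_⟩
      rw [← h2]
      have : 2 * Real.pi * (foldSeq k t l - 2 * (foldSeq k t l - 2 ^ k / 2 ^ (l + 2)))
          = (2 ^ (k - (l + 1)) : ℕ) * (2 * Real.pi) - 2 * Real.pi * foldSeq k t l := by
        rw [← e', e]; ring
      rw [this, Real.cos_nat_mul_two_pi_sub]

/-- The row that recovers `foldSeq k t l` from the layer with index `l` of the folding network. -/
def foldRow : ℕ → Fin 3 → ℝ
  | 0 => ![1, 1, 0]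
  | _ + 1 => ![1, -2, 0]

/-- A ridge function built from a truncated triangle wave is a ReLU network of width `3`, on the
region where the phase is at most `2^k/2`. -/
theorem exists_network {d : ℕ} (ξ : Space d) (τ A b : ℝ) (k : ℕ) :
    ∃ F : Space d → ℝ, IsReLUNetwork 3 (k + 2) F ∧
      ∀ x, |∑ j, ξ j * x j + τ| ≤ 2 ^ k / 2 → F x = A * wave b (∑ j, ξ j * x j + τ) := by
  set W₀ : Matrix (Fin 3) (Fin d) ℝ := ![fun j => ξ j, fun j => -ξ j, 0] with hW₀
  -- Layer `0` holds the positive and negative parts of the phase. Layer `l + 1 ≤ k` holds the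
  -- folded phase, which is nonnegative and so survives the ReLU, and its excess over the next
  -- threshold. Layer `k + 1` forms the two ReLUs of `wave_eq_relu`; its third node is the constant
  -- `1`, since the output map has no bias.
  set W : ℕ → Matrix (Fin 3) (Fin 3) ℝ := fun l =>
    if l < k then ![foldRow l, foldRow l, 0]
    else ![(2 * Real.pi) • foldRow l, (2 * Real.pi) • foldRow l, 0] with hW
  set β : ℕ → Fin 3 → ℝ := fun l => match l with
    | 0 => ![τ, -τ, 0]
    | l + 1 => if l < k then ![0, -(2 ^ k / 2 ^ (l + 2)), 0]
      else ![-(Real.pi / 2 - |b|), -(Real.pi / 2 + |b|), 1] with hβ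
  set c : Fin 3 → ℝ := ![-A, A, A * |b|] with hc
  refine ⟨fun x => ∑ i, c i * hiddenLayer W₀ W β (fun j => x j) (k + 2 - 1) i,
    ⟨by omega, W₀, W, β, c, fun _ => rfl⟩, fun x hx => ?_⟩
  set t := ∑ j, ξ j * x j + τ with ht
  have key : ∀ l ≤ k, foldRow l ⬝ᵥ hiddenLayer W₀ W β (fun j => x j) l = foldSeq k t l := by
    intro l
    induction l with
    | zero =>
      intro _
      have h0 : hiddenLayer W₀ W β (fun j => x j) 0 0 = max 0 t := by
        simp [hiddenLayer, reluLayer, W₀, β, Matrix.mulVec, dotProduct, ht]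
      have h1 : hiddenLayer W₀ W β (fun j => x j) 0 1 = max 0 (-t) := by
        simp [hiddenLayer, reluLayer, W₀, β, Matrix.mulVec, dotProduct, ht]
        ring_nf
      simp only [dotProduct, Fin.sum_univ_three, h0, h1, foldRow, foldSeq]
      rcases abs_cases t with ⟨h, h'⟩ | ⟨h, h'⟩
      · simp [h, h']
      · simp [h, h'.le]
    | succ l ih =>
      intro hl
      have hl' : l < k := by omega
      have ih := ih hl'.le
      have h0 : hiddenLayer W₀ W β (fun j => x j) (l + 1) 0 = foldSeq k t l := by
        have : hiddenLayer W₀ W β (fun j => x j) (l + 1) 0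
            = max 0 (foldRow l ⬝ᵥ hiddenLayer W₀ W β (fun j => x j) l + 0) := by
          simp [hiddenLayer, reluLayer, W, β, Matrix.mulVec, hl']
        rw [this, ih, add_zero, max_eq_right (foldSeq_spec hx hl'.le).1]
      have h1 : hiddenLayer W₀ W β (fun j => x j) (l + 1) 1
          = max 0 (foldSeq k t l - 2 ^ k / 2 ^ (l + 2)) := by
        have : hiddenLayer W₀ W β (fun j => x j) (l + 1) 1
            = max 0 (foldRow l ⬝ᵥ hiddenLayer W₀ W β (fun j => x j) l
              + -(2 ^ k / 2 ^ (l + 2))) := by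
          simp [hiddenLayer, reluLayer, W, β, Matrix.mulVec, hl']
        rw [this, ih, sub_eq_add_neg]
      simp only [dotProduct, Fin.sum_univ_three, h0, h1, foldRow, foldSeq]
      simp
      ring
  have hk := key k le_rfl
  obtain ⟨s0, s1, s2⟩ := foldSeq_spec hx le_rfl
  have s1' : foldSeq k t k ≤ 1 / 2 := by
    refine s1.trans (le_of_eq ?_)
    rw [pow_succ]; field_simp
  have hWk : W k = ![(2 * Real.pi) • foldRow k, (2 * Real.pi) • foldRow k, 0] :=
    if_neg (lt_irrefl k)
  have hβk : β (k + 1) = ![-(Real.pi / 2 - |b|), -(Real.pi / 2 + |b|), 1] :=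
    if_neg (lt_irrefl k)
  have h0 : hiddenLayer W₀ W β (fun j => x j) (k + 1) 0
      = max 0 (2 * Real.pi * foldSeq k t k - (Real.pi / 2 - |b|)) := by
    have : hiddenLayer W₀ W β (fun j => x j) (k + 1) 0
        = max 0 (((2 * Real.pi) • foldRow k) ⬝ᵥ hiddenLayer W₀ W β (fun j => x j) k
          + -(Real.pi / 2 - |b|)) := by
      change max 0 (W k 0 ⬝ᵥ hiddenLayer W₀ W β (fun j => x j) k + β (k + 1) 0) = _
      rw [hWk, hβk]
      rfl
    rw [this, smul_dotProduct, smul_eq_mul, hk, sub_eq_add_neg (2 * Real.pi * foldSeq k t k)]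
  have h1 : hiddenLayer W₀ W β (fun j => x j) (k + 1) 1
      = max 0 (2 * Real.pi * foldSeq k t k - (Real.pi / 2 + |b|)) := by
    have : hiddenLayer W₀ W β (fun j => x j) (k + 1) 1
        = max 0 (((2 * Real.pi) • foldRow k) ⬝ᵥ hiddenLayer W₀ W β (fun j => x j) k
          + -(Real.pi / 2 + |b|)) := by
      change max 0 (W k 1 ⬝ᵥ hiddenLayer W₀ W β (fun j => x j) k + β (k + 1) 1) = _
      rw [hWk, hβk]
      rfl
    rw [this, smul_dotProduct, smul_eq_mul, hk, sub_eq_add_neg (2 * Real.pi * foldSeq k t k)]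
  have h2 : hiddenLayer W₀ W β (fun j => x j) (k + 1) 2 = 1 := by
    simp [hiddenLayer, reluLayer, W, β, Matrix.mulVec]
  rw [wave_eq_relu b s0 s1' s2]
  simp only [show k + 2 - 1 = k + 1 by omega, Fin.sum_univ_three, h0, h1, h2]
  simp [c]
  ring

/-- With `s = |ξ|₁` and a shift of at most `1/2`, the phase on the cube is at most `s + 1/2`, so the
folding needs `2s + 1 ≤ 2^k`. -/
lemma exists_depth {s : ℝ} (hs : 0 ≤ s) :
    ∃ k : ℕ, 2 * s + 1 ≤ 2 ^ k ∧ ((k + 2 : ℕ) : ℝ) ≤ 4 * Real.logb 2 (2 + s) := by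
  obtain ⟨n, hn1, hn2⟩ := exists_nat_pow_near (x := 2 * s + 1) (y := (2 : ℝ)) (by linarith)
    (by norm_num)
  refine ⟨n + 1, hn2.le, ?_⟩
  -- `8 * 2^n ≤ 8(2s + 1)`, and this is below `(2 + s)^4`, whose expansion starts with `16 + 32s`.
  have h : (2 : ℝ) ^ (n + 1 + 2) ≤ (2 + s) ^ 4 := by
    rw [show (2 : ℝ) ^ (n + 1 + 2) = 8 * 2 ^ n by ring]
    nlinarith [pow_nonneg hs 2, pow_nonneg hs 3, pow_nonneg hs 4]
  have h2 := Real.logb_le_logb_of_le (b := 2) (by norm_num) (by positivity) h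
  rw [Real.logb_pow, Real.logb_pow, Real.logb_self_eq_one (by norm_num)] at h2
  simpa using h2

/-- The ridge function with frequency `ξ` is, on the unit cube, a ReLU network of width `3` and
of depth logarithmic in `|ξ|₁`. -/
theorem exists_network_on_cube {d : ℕ} (ξ : Space d) {τ : ℝ} (hτ : |τ| ≤ 1 / 2) (A b : ℝ) :
    ∃ (L : ℕ) (F : Space d → ℝ), IsReLUNetwork 3 L F ∧
      (L : ℝ) ≤ 4 * Real.logb 2 (2 + norm1 ξ) ∧
      ∀ x : Space d, (∀ i, x i ∈ Set.Icc (0 : ℝ) 1) →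
        F x = A * wave b (inner ℝ ξ x + τ) := by
  obtain ⟨k, hk, hk'⟩ := exists_depth (s := norm1 ξ) (Finset.sum_nonneg fun i _ => abs_nonneg _)
  obtain ⟨F, hF, hF'⟩ := exists_network ξ τ A b k
  refine ⟨k + 2, F, hF, hk', fun x hx => ?_⟩
  have e : inner ℝ ξ x = ∑ j, ξ j * x j := by
    rw [PiLp.inner_apply]
    exact Finset.sum_congr rfl fun j _ => by simp [mul_comm]
  rw [e]
  refine hF' x ((abs_add_le _ _).trans ?_)
  have : |∑ j, ξ j * x j| ≤ norm1 ξ := by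
    refine (Finset.abs_sum_le_sum_abs _ _).trans (Finset.sum_le_sum fun j _ => ?_)
    rw [abs_mul, abs_of_nonneg (hx j).1]
    exact mul_le_of_le_one_right (abs_nonneg _) (hx j).2
  linarith

/-! ### Greedy choice of samples -/

section Sampling

variable {S Y : Type*} [MeasurableSpace S] [MeasurableSpace Y]

lemma integrable_of_measurable_of_abs_le {ν : Measure Y} [IsFiniteMeasure ν] {u : Y → ℝ}
    (hu : Measurable u) {K : ℝ} (hK : ∀ y, |u y| ≤ K) : Integrable u ν :=
  Integrable.of_bound hu.aestronglyMeasurable K (Filter.Eventually.of_forall hK)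

/-- Adding an independent sample increases the expected squared error by at most its variance. -/
lemma integral_integral_add_sub_sq_le (P : Measure S) [IsProbabilityMeasure P] (ν : Measure Y)
    [IsFiniteMeasure ν] {U : S → Y → ℝ} (hU : Measurable (Function.uncurry U)) {K : ℝ}
    (hK : ∀ s y, |U s y| ≤ K) {v : Y → ℝ} (hv : Measurable v) {K' : ℝ} (hK' : ∀ y, |v y| ≤ K') :
    Integrable (fun s => ∫ y, (v y + (U s y - ∫ s', U s' y ∂P)) ^ 2 ∂ν) P ∧
    ∫ s, ∫ y, (v y + (U s y - ∫ s', U s' y ∂P)) ^ 2 ∂ν ∂P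
      ≤ ∫ y, v y ^ 2 ∂ν + ∫ s, ∫ y, U s y ^ 2 ∂ν ∂P := by
  set μ : Y → ℝ := fun y => ∫ s', U s' y ∂P with hμ
  have hμm : Measurable μ :=
    (hU.stronglyMeasurable.integral_prod_left (μ := P)).measurable
  have hμK : ∀ y, |μ y| ≤ K := fun y => by
    have := norm_integral_le_of_norm_le_const (μ := P) (f := fun s => U s y) (C := K)
      (Filter.Eventually.of_forall fun s => hK s y)
    simpa using this
  have hm : Measurable fun p : S × Y => (v p.2 + (U p.1 p.2 - μ p.2)) ^ 2 :=
    ((hv.comp measurable_snd).add (hU.sub (hμm.comp measurable_snd))).pow_const 2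
  have hint : Integrable (fun p : S × Y => (v p.2 + (U p.1 p.2 - μ p.2)) ^ 2) (P.prod ν) := by
    refine integrable_of_measurable_of_abs_le hm (K := (K' + (K + K)) ^ 2) fun p => ?_
    rw [abs_pow]
    refine pow_le_pow_left₀ (abs_nonneg _) ((abs_add_le _ _).trans (add_le_add (hK' _) ?_)) 2
    exact (abs_sub _ _).trans (add_le_add (hK _ _) (hμK _))
  have hint2 : Integrable (fun p : S × Y => U p.1 p.2 ^ 2) (P.prod ν) := by
    refine integrable_of_measurable_of_abs_le (hU.pow_const 2) (K := K ^ 2) fun p => ?_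
    rw [abs_pow]
    exact pow_le_pow_left₀ (abs_nonneg _) (hK _ _) 2
  refine ⟨hint.integral_prod_left, ?_⟩
  rw [integral_integral_swap (f := fun s y => (v y + (U s y - μ y)) ^ 2) hint,
    integral_integral_swap (f := fun s y => U s y ^ 2) hint2]
  have hv2 : Integrable (fun y => v y ^ 2) ν := by
    refine integrable_of_measurable_of_abs_le (hv.pow_const 2) (K := K' ^ 2) fun y => ?_
    rw [abs_pow]
    exact pow_le_pow_left₀ (abs_nonneg _) (hK' _) 2
  rw [← integral_add hv2 hint2.integral_prod_right]
  refine integral_mono hint.integral_prod_right (hv2.add hint2.integral_prod_right) fun y => ?_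
  have hUy : Measurable fun s => U s y := hU.comp measurable_prodMk_right
  have i1 : Integrable (fun s => U s y) P :=
    integrable_of_measurable_of_abs_le hUy fun s => hK s y
  have i2 : Integrable (fun s => U s y ^ 2) P := by
    refine integrable_of_measurable_of_abs_le (hUy.pow_const 2) (K := K ^ 2) fun s => ?_
    rw [abs_pow]
    exact pow_le_pow_left₀ (abs_nonneg _) (hK _ _) 2
  have e : ∀ s, (v y + (U s y - μ y)) ^ 2
      = U s y ^ 2 + 2 * (v y - μ y) * U s y + (v y - μ y) ^ 2 := fun s => by ring
  simp only [e]
  have i3 : Integrable (fun s => 2 * (v y - μ y) * U s y) P := i1.const_mul _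
  have i4 : Integrable (fun s => U s y ^ 2 + 2 * (v y - μ y) * U s y) P := i2.add i3
  rw [integral_add i4 (integrable_const _), integral_add i2 i3, integral_const_mul]
  simp only [integral_const, probReal_univ, one_smul]
  change _ + 2 * (v y - μ y) * μ y + _ ≤ _
  -- The left side equals `E[U²] + v² - μ²`: the cross term vanishes because `U - μ` is centred, and
  -- `-μ²` is dropped.
  nlinarith [sq_nonneg (μ y)]

/-- Samples of a family of random functions whose mean is close to the expectation in `L²`,
with control on an additional cost `g`. -/
theorem exists_samples {ι : Type*} [Fintype ι] (P : Measure S) [IsProbabilityMeasure P]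
    (ν : Measure Y) [IsFiniteMeasure ν] {U : ι → S → Y → ℝ}
    (hU : ∀ j, Measurable (Function.uncurry (U j))) {K : ℝ} (hK : ∀ j s y, |U j s y| ≤ K) {C : ℝ}
    (hC : ∀ s, ∑ j, ∫ y, U j s y ^ 2 ∂ν ≤ C) {g : S → ℝ} (hg : Integrable g P) (m : ℕ) :
    ∃ a : Fin m → S,
      ∑ j, ∫ y, (∑ i, (U j (a i) y - ∫ s, U j s y ∂P)) ^ 2 ∂ν + ∑ i, g (a i)
        ≤ m * (C + ∫ s, g s ∂P) := by
  induction m with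
  | zero => exact ⟨Fin.elim0, by simp⟩
  | succ m ih =>
    obtain ⟨a, ha⟩ := ih
    set v : ι → Y → ℝ := fun j y => ∑ i, (U j (a i) y - ∫ s, U j s y ∂P) with hv
    have hμm : ∀ j, Measurable fun y => ∫ s', U j s' y ∂P := fun j =>
      ((hU j).stronglyMeasurable.integral_prod_left (μ := P)).measurable
    have hμK : ∀ j y, |∫ s', U j s' y ∂P| ≤ K := fun j y => by
      have := norm_integral_le_of_norm_le_const (μ := P) (f := fun s => U j s y) (C := K)
        (Filter.Eventually.of_forall fun s => hK j s y)
      simpa using this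
    have hvm : ∀ j, Measurable (v j) := fun j =>
      Finset.measurable_sum _ fun i _ =>
        ((hU j).comp measurable_prodMk_left).sub (hμm j)
    have hvK : ∀ j y, |v j y| ≤ m * (K + K) := fun j y => by
      refine (Finset.abs_sum_le_sum_abs _ _).trans ?_
      refine (Finset.sum_le_card_nsmul _ _ (K + K) fun i _ => ?_).trans (by simp [mul_add])
      exact (abs_sub _ _).trans (add_le_add (hK _ _ _) (hμK _ _))
    have key := fun j =>
      integral_integral_add_sub_sq_le P ν (hU j) (hK j) (hvm j) (hvK j)
    have hI : Integrable (fun s => ∑ j, ∫ y, (v j y + (U j s y - ∫ s', U j s' y ∂P)) ^ 2 ∂ν) P :=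
      integrable_finsetSum _ fun j _ => (key j).1
    -- Error and cost are added before the sample is chosen, so that one sample is no worse than
    -- average for their sum.
    obtain ⟨s, hs⟩ := exists_le_integral (hI.add hg)
    have hUint : ∀ j, Integrable (fun s => ∫ y, U j s y ^ 2 ∂ν) P := fun j => by
      have : Integrable (fun p : S × Y => U j p.1 p.2 ^ 2) (P.prod ν) := by
        refine integrable_of_measurable_of_abs_le ((hU j).pow_const 2) (K := K ^ 2) fun p => ?_
        rw [abs_pow]
        exact pow_le_pow_left₀ (abs_nonneg _) (hK _ _ _) 2
      exact this.integral_prod_left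
    have hsum : ∑ j, ∫ s, ∫ y, U j s y ^ 2 ∂ν ∂P ≤ C := by
      rw [← integral_finsetSum _ fun j _ => hUint j]
      refine (integral_mono (integrable_finsetSum _ fun j _ => hUint j)
        (integrable_const C) hC).trans ?_
      simp
    refine ⟨Fin.snoc a s, ?_⟩
    simp only [Fin.sum_univ_castSucc, Fin.snoc_castSucc, Fin.snoc_last]
    simp only [Pi.add_apply] at hs
    rw [integral_add hI hg, integral_finsetSum _ fun j _ => (key j).1] at hs
    have h3 := Finset.sum_le_sum fun j (_ : j ∈ Finset.univ) => (key j).2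
    rw [Finset.sum_add_distrib] at h3
    push_cast
    linarith

end Sampling

/-! ### Distributions represented by functions -/

lemma IsRepresentedBy.ae_eq {d : ℕ} {T : 𝓢'(Space d, ℂ)} {h h' : Space d → ℂ}
    (H : IsRepresentedBy T h) (H' : IsRepresentedBy T h') : h =ᵐ[volume] h' := by
  refine ae_eq_of_integral_contDiff_smul_eq H.1 H'.1 fun g hg hgc => ?_
  have hg₁ : HasCompactSupport (Complex.ofRealCLM ∘ g) := hgc.comp_left rfl
  have hg₂ : ContDiff ℝ ∞ (Complex.ofRealCLM ∘ g) := by fun_prop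
  have h1 := (H.2 (hg₁.toSchwartzMap hg₂)).2
  rw [(H'.2 (hg₁.toSchwartzMap hg₂)).2] at h1
  simpa using h1.symm

lemma IsRepresentedBy.congr {d : ℕ} {T : 𝓢'(Space d, ℂ)} {h h' : Space d → ℂ}
    (H : IsRepresentedBy T h) (e : h =ᵐ[volume] h') : IsRepresentedBy T h' := by
  refine ⟨(locallyIntegrable_congr e).1 H.1, fun φ => ?_⟩
  have e' : (fun x => φ x * h x) =ᵐ[volume] fun x => φ x * h' x :=
    e.mono fun x hx => by simp only [hx]
  exact ⟨(H.2 φ).1.congr e', (H.2 φ).2.trans (integral_congr_ae e')⟩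

/-- The infimum runs over a single almost-everywhere class, on which the integral is constant. -/
lemma fourierWeightNorm_eq {d : ℕ} (w : Space d → ℝ) {T : 𝓢'(Space d, ℂ)} {h : Space d → ℂ}
    (H : IsRepresentedBy (𝓕 T) h) :
    fourierWeightNorm w T = ∫⁻ ξ, ENNReal.ofReal (w ξ) * ‖h ξ‖ₑ := by
  refine le_antisymm (iInf₂_le h H) (le_iInf₂ fun h' H' => le_of_eq ?_)
  exact lintegral_congr_ae ((H.ae_eq H').mono fun ξ hξ => by simp only [hξ])

lemma exists_measurable_isRepresentedBy {d : ℕ} {w : Space d → ℝ} {T : 𝓢'(Space d, ℂ)}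
    (hT : fourierWeightNorm w T < ⊤) : ∃ h : Space d → ℂ, Measurable h ∧
      IsRepresentedBy (𝓕 T) h := by
  obtain ⟨h, hh⟩ := iInf_lt_iff.1 hT
  obtain ⟨H, -⟩ := iInf_lt_iff.1 hh
  have hm := H.1.aestronglyMeasurable
  exact ⟨hm.mk h, hm.stronglyMeasurable_mk.measurable, H.congr hm.ae_eq_mk⟩

/-- Duality: `T φ = 𝓕 T (𝓕⁻ φ) = ∫ 𝓕⁻ φ * h = ∫ φ * 𝓕⁻ h`, by Fubini and the symmetry of the kernel.
-/
lemma IsRepresentedBy.fourierInv {d : ℕ} {T : 𝓢'(Space d, ℂ)} {h : Space d → ℂ}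
    (H : IsRepresentedBy (𝓕 T) h) (hi : Integrable h) :
    Continuous (𝓕⁻ h) ∧ IsRepresentedBy T (𝓕⁻ h) := by
  have hL : Continuous fun p : Space d × Space d => (-innerₗ (Space d)) p.1 p.2 :=
    (continuous_inner (𝕜 := ℝ) (E := Space d)).neg
  have hc : Continuous (𝓕⁻ h) :=
    VectorFourier.fourierIntegral_continuous Real.continuous_fourierChar
      (L := -innerₗ (Space d)) hL hi
  refine ⟨hc, hc.locallyIntegrable, fun φ => ⟨?_, ?_⟩⟩
  · refine φ.integrable.mul_bdd (c := ∫ ξ, ‖h ξ‖) hc.aestronglyMeasurable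
      (Filter.Eventually.of_forall fun x => ?_)
    exact VectorFourier.norm_fourierIntegral_le_integral_norm _ _ _ _ _
  · have e : T φ = 𝓕 T (𝓕⁻ φ) := by
      rw [TemperedDistribution.fourier_apply, FourierTransform.fourier_fourierInv_eq]
    rw [e, (H.2 _).2]
    have := VectorFourier.integral_fourierIntegral_smul_eq_flip (L := -innerₗ (Space d))
      (μ := volume) (ν := volume) (f := φ) (g := h)
      Real.continuous_fourierChar hL
      φ.integrable hi
    have hflip : (-innerₗ (Space d)).flip = -innerₗ (Space d) := by
      ext x y
      simp [real_inner_comm]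
    rw [hflip] at this
    simp only [SchwartzMap.fourierInv_coe]
    exact this

/-- Real test functions show that the imaginary part vanishes almost everywhere; continuity removes
the exceptional set. -/
lemma IsReal.im_eq_zero {d : ℕ} {T : 𝓢'(Space d, ℂ)} (hT : IsReal T) {F : Space d → ℂ}
    (hF : Continuous F) (H : IsRepresentedBy T F) (x : Space d) : (F x).im = 0 := by
  have hc : Continuous fun x => (F x).im := Complex.continuous_im.comp hF
  have key : ∀ᵐ x : Space d, (F x).im = 0 := by
    refine ae_eq_zero_of_integral_contDiff_smul_eq_zero hc.locallyIntegrable fun g hg hgc => ?_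
    have hg₁ : HasCompactSupport (Complex.ofRealCLM ∘ g) := hgc.comp_left rfl
    have hg₂ : ContDiff ℝ ∞ (Complex.ofRealCLM ∘ g) := by fun_prop
    obtain ⟨h1, h2⟩ := H.2 (hg₁.toSchwartzMap hg₂)
    have h3 := hT (hg₁.toSchwartzMap hg₂) fun x => by simp
    rw [h2] at h3
    have h4 := integral_im h1
    simp only [RCLike.im_to_complex] at h4
    rw [← h4] at h3
    simpa using h3
  exact congrFun ((Continuous.ae_eq_iff_eq volume hc continuous_const).1 key) x

/-- A real distribution with integrable Fourier transform `h` is a continuous function, given by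
Fourier inversion. -/
theorem IsReal.isRepresentedBy_integral_cos {d : ℕ} {T : 𝓢'(Space d, ℂ)} (hT : IsReal T)
    {h : Space d → ℂ} (H : IsRepresentedBy (𝓕 T) h) (hi : Integrable h) {f : Space d → ℝ}
    (hf : ∀ x, f x = ∫ ξ, ‖h ξ‖ *
      Real.cos (2 * Real.pi * (inner ℝ ξ x + Complex.arg (h ξ) / (2 * Real.pi)))) :
    Continuous f ∧ IsRepresentedBy T (fun x => (f x : ℂ)) := by
  obtain ⟨hc, hR⟩ := H.fourierInv hi
  have him := hT.im_eq_zero hc hR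
  have e : ∀ x, f x = (𝓕⁻ h x).re := fun x => by
    have hi' : Integrable fun ξ => Complex.exp (↑(2 * Real.pi * inner ℝ ξ x) * Complex.I) • h ξ := by
      refine hi.bdd_mul (c := 1) (Continuous.aestronglyMeasurable (by fun_prop))
        (Filter.Eventually.of_forall fun ξ => ?_)
      rw [Complex.norm_exp_ofReal_mul_I]
    rw [hf, Real.fourierInv_eq', ← RCLike.re_to_complex, ← integral_re hi']
    refine integral_congr_ae (Filter.Eventually.of_forall fun ξ => ?_)
    simp only [RCLike.re_to_complex, smul_eq_mul]
    conv_rhs => rw [← Complex.norm_mul_exp_arg_mul_I (h ξ)]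
    rw [mul_left_comm, ← Complex.exp_add, ← add_mul, ← Complex.ofReal_add, Complex.re_ofReal_mul,
      Complex.exp_ofReal_mul_I_re, mul_add, mul_div_cancel₀ _ (by positivity)]
  have e' : (fun x => (f x : ℂ)) = 𝓕⁻ h := by
    funext x
    apply Complex.ext
    · simp [e]
    · simp [him]
  refine ⟨?_, e' ▸ hR⟩
  rw [show f = fun x => (𝓕⁻ h x).re from funext e]
  exact Complex.continuous_re.comp hc

/-! ### Weak derivatives of Lipschitz functions -/

lemma hasWeakPartialDeriv_of_lipschitzWith {d : ℕ} {u : Space d → ℝ} {K : NNReal}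
    (hu : LipschitzWith K u) (j : Fin d) :
    HasWeakPartialDeriv j u fun x => lineDeriv ℝ u x (EuclideanSpace.single j 1) := by
  refine ⟨hu.continuous.locallyIntegrable, hu.locallyIntegrable_lineDeriv _,
    fun φ hφ hφc => ?_⟩
  obtain ⟨C, hC⟩ := ContDiff.lipschitzWith_of_hasCompactSupport hφc hφ (by simp)
  rw [hu.integral_lineDeriv_mul_eq hC hφc, ← integral_neg]
  refine integral_congr_ae (Filter.Eventually.of_forall fun x => ?_)
  simp only [lineDeriv_neg]
  rw [((hφ.differentiable (by simp)).differentiableAt (x := x)).lineDeriv_eq_fderiv]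
  ring

lemma h1NormSq_le_of_lipschitzWith {d : ℕ} (Ω : Set (Space d)) {u : Space d → ℝ} {K : NNReal}
    (hu : LipschitzWith K u) :
    h1NormSq Ω u ≤ (∫⁻ x in Ω, ‖u x‖ₑ ^ 2)
      + ∑ j, ∫⁻ x in Ω, ‖lineDeriv ℝ u x (EuclideanSpace.single j 1)‖ₑ ^ 2 :=
  iInf₂_le _ fun j => hasWeakPartialDeriv_of_lipschitzWith hu j

/-! ### Random ridge waves -/

/-- The probability measure `sin b db` on `(0, π/2]`. -/
noncomputable def sineMeasure : Measure ℝ :=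
  (volume.restrict (Set.Ioc 0 (Real.pi / 2))).withDensity fun b => ENNReal.ofReal (Real.sin b)

lemma sin_nonneg_of_mem {b : ℝ} (hb : b ∈ Set.Ioc 0 (Real.pi / 2)) : 0 ≤ Real.sin b :=
  Real.sin_nonneg_of_nonneg_of_le_pi hb.1.le (by linarith [hb.2, Real.pi_pos])

lemma integral_sineMeasure (g : ℝ → ℝ) :
    ∫ b, g b ∂sineMeasure = ∫ b in (0 : ℝ)..(Real.pi / 2), g b * Real.sin b := by
  rw [sineMeasure, integral_withDensity_eq_integral_toReal_smul (by fun_prop)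
    (Filter.Eventually.of_forall fun _ => ENNReal.ofReal_lt_top),
    intervalIntegral.integral_of_le (by positivity)]
  refine setIntegral_congr_fun measurableSet_Ioc fun b hb => ?_
  simp only [ENNReal.toReal_ofReal (sin_nonneg_of_mem hb), smul_eq_mul, mul_comm]

instance : IsProbabilityMeasure sineMeasure := by
  refine ⟨?_⟩
  rw [sineMeasure, withDensity_apply _ MeasurableSet.univ, Measure.restrict_univ,
    ← ofReal_integral_eq_lintegral_ofReal, ← intervalIntegral.integral_of_le (by positivity),
    integral_sin]
  · simp
  · exact (Real.continuous_sin.intervalIntegrable 0 (Real.pi / 2)).1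
  · exact (ae_restrict_mem measurableSet_Ioc).mono fun b hb => sin_nonneg_of_mem hb

lemma ae_sineMeasure_of_ae {p : ℝ → Prop}
    (hp : ∀ᵐ b ∂volume.restrict (Set.Ioc 0 (Real.pi / 2)), p b) : ∀ᵐ b ∂sineMeasure, p b :=
  (withDensity_absolutelyContinuous _ _).ae_le hp

section RidgeWave

variable {d : ℕ}

lemma norm1_nonneg (ξ : Space d) : 0 ≤ norm1 ξ := Finset.sum_nonneg fun _ _ => abs_nonneg _

lemma abs_apply_le_norm1 (ξ : Space d) (j : Fin d) : |ξ j| ≤ norm1 ξ :=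
  Finset.single_le_sum (f := fun i => |ξ i|) (fun _ _ => abs_nonneg _) (Finset.mem_univ j)

lemma sum_sq_le_norm1_sq (ξ : Space d) : ∑ j, ξ j ^ 2 ≤ norm1 ξ ^ 2 := by
  simp only [← sq_abs (ξ _)]
  exact Finset.sum_sq_le_sq_sum_of_nonneg fun _ _ => abs_nonneg _

lemma norm_le_norm1 (ξ : Space d) : ‖ξ‖ ≤ norm1 ξ := by
  rw [EuclideanSpace.norm_eq]
  refine Real.sqrt_le_iff.2 ⟨norm1_nonneg ξ, ?_⟩
  simpa using sum_sq_le_norm1_sq ξ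

lemma one_le_logb_two_add_norm1 (ξ : Space d) : 1 ≤ Real.logb 2 (2 + norm1 ξ) := by
  rw [Real.le_logb_iff_rpow_le (by norm_num) (by linarith [norm1_nonneg ξ]), Real.rpow_one]
  linarith [norm1_nonneg ξ]

lemma measurable_norm1 : Measurable (norm1 : Space d → ℝ) := by
  unfold norm1
  fun_prop

/-- The ridge function with frequency `s.1`, amplitude `A s.1`, phase `τ s.1` and truncation level
`s.2` (`none`), and its partial derivatives (`some j`). -/
noncomputable def ridge (A τ : Space d → ℝ) : Option (Fin d) → Space d × ℝ → Space d → ℝ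
  | none, s, x => A s.1 * wave s.2 (inner ℝ s.1 x + τ s.1)
  | some j, s, x => A s.1 * s.1 j * deriv (wave s.2) (inner ℝ s.1 x + τ s.1)

variable {A τ : Space d → ℝ}

lemma measurable_ridge (hA : Measurable A) (hτ : Measurable τ) (j : Option (Fin d)) :
    Measurable (Function.uncurry (ridge A τ j)) := by
  have hm : Measurable fun p : (Space d × ℝ) × Space d =>
      (p.1.2, inner ℝ p.1.1 p.2 + τ p.1.1) := by fun_prop
  cases j with
  | none =>
    exact (hA.comp (measurable_fst.comp measurable_fst)).mul (continuous_wave.measurable.comp hm)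
  | some j =>
    refine Measurable.mul ?_ ((measurable_deriv_with_param continuous_wave).comp hm)
    exact (hA.comp (measurable_fst.comp measurable_fst)).mul (by fun_prop)

variable {B : ℝ}

lemma ridge_bound (hA0 : ∀ ξ, 0 ≤ A ξ) (hAB : ∀ ξ, A ξ * (1 + norm1 ξ) ≤ B)
    (j : Option (Fin d)) (s : Space d × ℝ) (x : Space d) : |ridge A τ j s x| ≤ 2 * Real.pi * B := by
  have hpi := Real.pi_pos
  have h1 := norm1_nonneg s.1
  have hA := hA0 s.1
  have hB := hAB s.1
  cases j with
  | none =>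
    rw [ridge, abs_mul, abs_of_nonneg hA]
    have := mul_le_mul_of_nonneg_left (abs_wave_le s.2 (inner ℝ s.1 x + τ s.1)) hA
    nlinarith [mul_nonneg hA h1]
  | some j =>
    rw [ridge, abs_mul, abs_mul, abs_of_nonneg hA]
    calc A s.1 * |s.1 j| * |deriv (wave s.2) (inner ℝ s.1 x + τ s.1)|
        ≤ A s.1 * norm1 s.1 * (2 * Real.pi) := by
          gcongr
          · exact abs_apply_le_norm1 _ _
          · exact abs_deriv_wave_le _ _
      _ ≤ 2 * Real.pi * B := by nlinarith

/-- The sum is at most `(2πA)² (1 + |ξ|₁²)`, since `∑ ξ_j² ≤ |ξ|₁²`. Hence no factor `d` appears,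
and this bound supplies the variance in the sampling argument. -/
lemma sum_ridge_sq_le (hA0 : ∀ ξ, 0 ≤ A ξ) (hAB : ∀ ξ, A ξ * (1 + norm1 ξ) ≤ B)
    (s : Space d × ℝ) (x : Space d) : ∑ j, ridge A τ j s x ^ 2 ≤ (2 * Real.pi * B) ^ 2 := by
  have hpi := Real.pi_pos
  have h1 := norm1_nonneg s.1
  have hA := hA0 s.1
  rw [Fintype.sum_option]
  have e1 : ridge A τ none s x ^ 2 ≤ (2 * Real.pi) ^ 2 * A s.1 ^ 2 := by
    rw [ridge, mul_pow, ← sq_abs (wave _ _), mul_comm]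
    gcongr
    exact (abs_wave_le _ _).trans (by linarith)
  have e2 : ∑ j, ridge A τ (some j) s x ^ 2 ≤ (2 * Real.pi) ^ 2 * A s.1 ^ 2 * norm1 s.1 ^ 2 := by
    calc ∑ j, ridge A τ (some j) s x ^ 2
        ≤ ∑ j, (2 * Real.pi) ^ 2 * A s.1 ^ 2 * s.1 j ^ 2 := by
          refine Finset.sum_le_sum fun j _ => ?_
          rw [ridge, mul_pow, mul_pow, ← sq_abs (deriv _ _), mul_comm, ← mul_assoc]
          gcongr
          exact abs_deriv_wave_le _ _
      _ ≤ _ := by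
          rw [← Finset.mul_sum]
          gcongr
          exact sum_sq_le_norm1_sq _
  calc _ ≤ (2 * Real.pi) ^ 2 * A s.1 ^ 2 + (2 * Real.pi) ^ 2 * A s.1 ^ 2 * norm1 s.1 ^ 2 :=
        add_le_add e1 e2
    _ ≤ (2 * Real.pi * (A s.1 * (1 + norm1 s.1))) ^ 2 := by
        have : 0 ≤ (2 * Real.pi) ^ 2 * A s.1 ^ 2 * norm1 s.1 := by positivity
        nlinarith
    _ ≤ _ := by
        gcongr
        exact hAB _

lemma ridge_lipschitz (hA0 : ∀ ξ, 0 ≤ A ξ) (hAB : ∀ ξ, A ξ * (1 + norm1 ξ) ≤ B)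
    (s : Space d × ℝ) (x y : Space d) :
    |ridge A τ none s x - ridge A τ none s y| ≤ 2 * Real.pi * B * ‖x - y‖ := by
  have hA := hA0 s.1
  have hpi := Real.pi_pos
  have h := (lipschitzWith_wave s.2).dist_le_mul (inner ℝ s.1 x + τ s.1) (inner ℝ s.1 y + τ s.1)
  rw [Real.coe_toNNReal _ (by positivity), Real.dist_eq, Real.dist_eq, add_sub_add_right_eq_sub,
    ← inner_sub_right] at h
  have h2 : |inner ℝ s.1 (x - y)| ≤ norm1 s.1 * ‖x - y‖ :=
    (abs_real_inner_le_norm _ _).trans (by gcongr; exact norm_le_norm1 _)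
  rw [ridge, ridge, ← mul_sub, abs_mul, abs_of_nonneg hA]
  calc _ ≤ A s.1 * (2 * Real.pi * (norm1 s.1 * ‖x - y‖)) := by
        gcongr
        exact h.trans (by gcongr)
    _ = 2 * Real.pi * (A s.1 * norm1 s.1) * ‖x - y‖ := by ring
    _ ≤ _ := by
        gcongr
        linarith [hAB s.1]

lemma inner_add_smul_single (ξ x : Space d) (t : ℝ) (j : Fin d) :
    inner ℝ ξ (x + t • EuclideanSpace.single j (1 : ℝ)) = inner ℝ ξ x + t * ξ j := by
  rw [inner_add_right, real_inner_smul_right, EuclideanSpace.inner_single_right]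
  simp

/-- No differentiability is needed: at a kink both sides take the default value `0`, and for `s.1 j
= 0` the function is constant along the line. -/
lemma lineDeriv_ridge (s : Space d × ℝ) (x : Space d) (j : Fin d) :
    lineDeriv ℝ (ridge A τ none s) x (EuclideanSpace.single j 1) = ridge A τ (some j) s x := by
  simp only [lineDeriv, ridge, inner_add_smul_single]
  have e : (fun t : ℝ => A s.1 * wave s.2 (inner ℝ s.1 x + t * s.1 j + τ s.1))
      = fun t => A s.1 * (fun r => wave s.2 ((inner ℝ s.1 x + τ s.1) + r)) (s.1 j * t) := by
    funext t
    congr 2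
    ring
  rw [e, deriv_const_mul_field,
    deriv_comp_mul_left (s.1 j) (fun r => wave s.2 (inner ℝ s.1 x + τ s.1 + r)),
    deriv_comp_const_add]
  simp [mul_assoc]

lemma hasDerivAt_ridge {s : Space d × ℝ} {x : Space d} (h0 : 0 < s.2) (h1 : s.2 < Real.pi / 2)
    (hne : |Real.arcsin (Real.cos (2 * Real.pi * (inner ℝ s.1 x + τ s.1)))| ≠ s.2) (j : Fin d) :
    HasLineDerivAt ℝ (ridge A τ none s) (ridge A τ (some j) s x) x
      (EuclideanSpace.single j 1) := by
  rw [← lineDeriv_ridge]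
  refine LineDifferentiableAt.hasLineDerivAt ?_
  unfold LineDifferentiableAt
  simp only [ridge, inner_add_smul_single]
  refine DifferentiableAt.const_mul ?_ _
  refine DifferentiableAt.fun_comp' (g := wave s.2) 0 ?_ (by fun_prop)
  simpa using differentiableAt_wave h1 h0 hne

/-! ### Differentiating the mean of the ridge waves -/

section Expectation

/-- For each `ξ` at most one level `b` in `(0, π/2)` puts a kink at `x`, and `sineMeasure` has no
atoms. This needs nothing of `ρ`, because `b` alone supplies the randomness. -/
lemma ae_hasDerivAt_ridge (ρ : Measure (Space d)) (hτ : Measurable τ) (x : Space d) (j : Fin d) :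
    ∀ᵐ s ∂ρ.prod sineMeasure, HasLineDerivAt ℝ (ridge A τ none s) (ridge A τ (some j) s x) x
      (EuclideanSpace.single j 1) := by
  have key : ∀ᵐ s ∂ρ.prod sineMeasure, 0 < s.2 ∧ s.2 < Real.pi / 2 ∧
      ¬ |Real.arcsin (Real.cos (2 * Real.pi * (inner ℝ s.1 x + τ s.1)))| = s.2 := by
    rw [Measure.ae_prod_iff_ae_ae]
    · refine Filter.Eventually.of_forall fun ξ => ae_sineMeasure_of_ae ?_
      have h1 : ∀ᵐ b : ℝ, b ≠ Real.pi / 2 := by simp [ae_iff]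
      have h2 : ∀ᵐ b : ℝ,
          b ≠ |Real.arcsin (Real.cos (2 * Real.pi * (inner ℝ ξ x + τ ξ)))| := by simp [ae_iff]
      filter_upwards [ae_restrict_mem measurableSet_Ioc, ae_restrict_of_ae h1,
        ae_restrict_of_ae h2] with b hb hb1 hb2
      exact ⟨hb.1, lt_of_le_of_ne hb.2 hb1, hb2.symm⟩
    · have hm : Measurable fun s : Space d × ℝ =>
          |Real.arcsin (Real.cos (2 * Real.pi * (inner ℝ s.1 x + τ s.1)))| := by
        have := Real.measurable_arcsin
        fun_prop
      exact (measurableSet_lt measurable_const measurable_snd).inter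
        ((measurableSet_lt measurable_snd measurable_const).inter
          (measurableSet_eq_fun hm measurable_snd).compl)
  exact key.mono fun s hs => hasDerivAt_ridge hs.1 hs.2.1 hs.2.2 j

variable (ρ : Measure (Space d)) [IsProbabilityMeasure ρ]

lemma integrable_ridge (hA : Measurable A) (hτ : Measurable τ) (hA0 : ∀ ξ, 0 ≤ A ξ)
    (hAB : ∀ ξ, A ξ * (1 + norm1 ξ) ≤ B) (j : Option (Fin d)) (x : Space d) :
    Integrable (fun s => ridge A τ j s x) (ρ.prod sineMeasure) :=
  integrable_of_measurable_of_abs_le ((measurable_ridge hA hτ j).comp measurable_prodMk_right)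
    fun s => ridge_bound hA0 hAB j s x

lemma integral_ridge (hA : Measurable A) (hτ : Measurable τ) (hA0 : ∀ ξ, 0 ≤ A ξ)
    (hAB : ∀ ξ, A ξ * (1 + norm1 ξ) ≤ B) (x : Space d) :
    ∫ s, ridge A τ none s x ∂ρ.prod sineMeasure
      = ∫ ξ, A ξ * Real.cos (2 * Real.pi * (inner ℝ ξ x + τ ξ)) ∂ρ := by
  rw [integral_prod _ (integrable_ridge ρ hA hτ hA0 hAB none x)]
  simp only [ridge]
  refine integral_congr_ae (Filter.Eventually.of_forall fun ξ => ?_)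
  simp only
  rw [integral_const_mul, integral_sineMeasure, integral_wave_mul_sin]

lemma hasLineDerivAt_integral_ridge (hA : Measurable A) (hτ : Measurable τ) (hA0 : ∀ ξ, 0 ≤ A ξ)
    (hAB : ∀ ξ, A ξ * (1 + norm1 ξ) ≤ B) (x : Space d) (j : Fin d) :
    HasLineDerivAt ℝ (fun x => ∫ s, ridge A τ none s x ∂ρ.prod sineMeasure)
      (∫ s, ridge A τ (some j) s x ∂ρ.prod sineMeasure) x (EuclideanSpace.single j 1) := by
  have hB : 0 ≤ 2 * Real.pi * B := (abs_nonneg _).trans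
    (ridge_bound (τ := τ) hA0 hAB none (0, 0) 0)
  refine (hasDerivAt_integral_of_dominated_loc_of_lip (s := Set.univ)
    (F := fun t s => ridge A τ none s (x + t • EuclideanSpace.single j 1))
    (bound := fun _ => 2 * Real.pi * B) Filter.univ_mem
    (Filter.Eventually.of_forall fun t =>
      (integrable_ridge ρ hA hτ hA0 hAB none _).aestronglyMeasurable)
    (integrable_ridge ρ hA hτ hA0 hAB none _)
    (integrable_ridge ρ hA hτ hA0 hAB (some j) x).aestronglyMeasurable
    (Filter.Eventually.of_forall fun s => ?_) (integrable_const _)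
    (ae_hasDerivAt_ridge ρ hτ x j)).2
  refine LipschitzWith.lipschitzOnWith (LipschitzWith.of_dist_le_mul fun t t' => ?_)
  rw [Real.dist_eq, Real.dist_eq, Real.coe_nnabs, abs_of_nonneg hB]
  refine (ridge_lipschitz hA0 hAB s _ _).trans (le_of_eq ?_)
  rw [add_sub_add_left_eq_sub, ← sub_smul, norm_smul]
  simp

lemma lipschitzWith_integral_ridge (hA : Measurable A) (hτ : Measurable τ) (hA0 : ∀ ξ, 0 ≤ A ξ)
    (hAB : ∀ ξ, A ξ * (1 + norm1 ξ) ≤ B) :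
    LipschitzWith (2 * Real.pi * B).toNNReal
      (fun x => ∫ s, ridge A τ none s x ∂ρ.prod sineMeasure) := by
  have hB : 0 ≤ 2 * Real.pi * B := (abs_nonneg _).trans
    (ridge_bound (τ := τ) hA0 hAB none (0, 0) 0)
  refine LipschitzWith.of_dist_le_mul fun x y => ?_
  rw [Real.coe_toNNReal _ hB, dist_eq_norm, dist_eq_norm,
    ← integral_sub (integrable_ridge ρ hA hτ hA0 hAB none x)
      (integrable_ridge ρ hA hτ hA0 hAB none y)]
  have := norm_integral_le_of_norm_le_const (μ := ρ.prod sineMeasure)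
    (f := fun s => ridge A τ none s x - ridge A τ none s y)
    (C := 2 * Real.pi * B * ‖x - y‖)
    (Filter.Eventually.of_forall fun s => ridge_lipschitz hA0 hAB s x y)
  simpa using this

end Expectation

end RidgeWave

/-! ### Approximation of mixtures of ridge functions -/

section Mixture

variable {d : ℕ}

lemma lintegral_enorm_sq_eq {Y : Type*} [MeasurableSpace Y] {ν : Measure Y} [IsFiniteMeasure ν]
    {D : Y → ℝ} (hD : Measurable D) {K : ℝ} (hK : ∀ y, |D y| ≤ K) :
    ∫⁻ y, ‖D y‖ₑ ^ 2 ∂ν = ENNReal.ofReal (∫ y, D y ^ 2 ∂ν) := by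
  rw [ofReal_integral_eq_lintegral_ofReal]
  · refine lintegral_congr fun y => ?_
    rw [← sq_abs, ENNReal.ofReal_pow (abs_nonneg _), ← Real.norm_eq_abs, ofReal_norm]
  · refine integrable_of_measurable_of_abs_le (hD.pow_const 2) (K := K ^ 2) fun y => ?_
    rw [abs_pow]
    exact pow_le_pow_left₀ (abs_nonneg _) (hK _) 2
  · exact Filter.Eventually.of_forall fun y => sq_nonneg _

/-- The closed unit cube. -/
def cube (d : ℕ) : Set (Space d) := {x | ∀ i, x i ∈ Set.Icc (0 : ℝ) 1}

lemma convex_cube : Convex ℝ (cube d) := fun _ hx _ hy _ _ ha hb hab i =>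
  convex_Icc (0 : ℝ) 1 (hx i) (hy i) ha hb hab

/-- The frontier of a convex set is null. Interior points are needed because agreement on the cube
determines derivatives only there. -/
lemma ae_mem_interior_cube {Ω : Set (Space d)} (hΩ : MeasurableSet Ω) (hsub : Ω ⊆ cube d) :
    ∀ᵐ x ∂volume.restrict Ω, x ∈ interior (cube d) := by
  have h : ∀ᵐ x : Space d, x ∉ frontier (cube d) :=
    measure_eq_zero_iff_ae_notMem.1 (convex_cube.addHaar_frontier volume)
  filter_upwards [ae_restrict_of_ae h, ae_restrict_mem hΩ] with x hx hxΩ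
  by_contra hi
  exact hx ⟨subset_closure (hsub hxΩ), hi⟩

variable {A τ : Space d → ℝ} {B : ℝ}

/-- The `H¹` error of an average of networks, expressed through the ridge functions with which the
networks agree on the cube. -/
lemma h1NormSq_average_le (ρ : Measure (Space d)) [IsProbabilityMeasure ρ]
    (hA : Measurable A) (hτ : Measurable τ) (hA0 : ∀ ξ, 0 ≤ A ξ)
    (hAB : ∀ ξ, A ξ * (1 + norm1 ξ) ≤ B) {Ω : Set (Space d)} (hΩ : IsCompact Ω)
    (hsub : Ω ⊆ cube d) {m : ℕ} (hm : 1 ≤ m) (a : Fin m → Space d × ℝ)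
    {F : Fin m → Space d → ℝ} (hF : ∀ i, ∃ K, LipschitzWith K (F i))
    (hFa : ∀ i, ∀ x ∈ cube d, F i x = ridge A τ none (a i) x) :
    h1NormSq Ω (fun x => ∫ s, ridge A τ none s x ∂ρ.prod sineMeasure
        - (1 / (m : ℝ)) * ∑ i, F i x)
      ≤ ENNReal.ofReal ((1 / (m : ℝ)) ^ 2 * ∑ j, ∫ x in Ω,
          (∑ i, (ridge A τ j (a i) x - ∫ s, ridge A τ j s x ∂ρ.prod sineMeasure)) ^ 2) := by
  have hm0 : (m : ℝ) ≠ 0 := by positivity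
  have : IsFiniteMeasure (volume.restrict Ω) := ⟨by simpa using hΩ.measure_lt_top⟩
  set μ : Option (Fin d) → Space d → ℝ :=
    fun j x => ∫ s, ridge A τ j s x ∂ρ.prod sineMeasure with hμ
  set D : Option (Fin d) → Space d → ℝ := fun j x => ∑ i, (ridge A τ j (a i) x - μ j x) with hD
  have hμm : ∀ j, Measurable (μ j) := fun j =>
    ((measurable_ridge hA hτ j).stronglyMeasurable.integral_prod_left
      (μ := ρ.prod sineMeasure)).measurable
  have hμB : ∀ j x, |μ j x| ≤ 2 * Real.pi * B := fun j x => by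
    have := norm_integral_le_of_norm_le_const (μ := ρ.prod sineMeasure)
      (f := fun s => ridge A τ j s x)
      (Filter.Eventually.of_forall fun s => ridge_bound hA0 hAB j s x)
    simpa using this
  have hDm : ∀ j, Measurable (D j) := fun j => Finset.measurable_sum _ fun i _ =>
    ((measurable_ridge hA hτ j).comp measurable_prodMk_left).sub (hμm j)
  have hDB : ∀ j x, |D j x| ≤ ∑ _i : Fin m, (2 * Real.pi * B + 2 * Real.pi * B) := fun j x =>
    (Finset.abs_sum_le_sum_abs _ _).trans (Finset.sum_le_sum fun i _ =>
      (abs_sub _ _).trans (add_le_add (ridge_bound hA0 hAB _ _ _) (hμB _ _)))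
  have hL : ∀ j, ∫⁻ x in Ω, ‖-(1 / (m : ℝ)) * D j x‖ₑ ^ 2
      = ENNReal.ofReal ((1 / (m : ℝ)) ^ 2 * ∫ x in Ω, D j x ^ 2) := fun j => by
    rw [lintegral_enorm_sq_eq ((hDm j).const_mul _)
      (K := |-(1 / (m : ℝ))| * ∑ _i : Fin m, (2 * Real.pi * B + 2 * Real.pi * B))]
    · simp only [mul_pow, integral_const_mul, neg_sq]
    · intro x
      rw [abs_mul]
      exact mul_le_mul_of_nonneg_left (hDB j x) (abs_nonneg _)
  have hu0 : ∀ x, μ none x - (1 / (m : ℝ)) * ∑ i, ridge A τ none (a i) x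
      = -(1 / (m : ℝ)) * D none x := fun x => by
    simp only [hD, Finset.sum_sub_distrib, Finset.sum_const, Finset.card_univ, Fintype.card_fin,
      nsmul_eq_mul]
    field_simp
    ring
  obtain ⟨K₁, hK₁⟩ := exists_lipschitzWith_affine hF (fun _ => 1 / (m : ℝ)) 0
  have hlip : LipschitzWith ((2 * Real.pi * B).toNNReal + K₁)
      (fun x => μ none x - (1 / (m : ℝ)) * ∑ i, F i x) := by
    have := (lipschitzWith_integral_ridge ρ hA hτ hA0 hAB).sub hK₁
    simpa only [add_zero, ← Finset.mul_sum] using this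
  refine (h1NormSq_le_of_lipschitzWith Ω hlip).trans ?_
  have h0 : ∫⁻ x in Ω, ‖μ none x - (1 / (m : ℝ)) * ∑ i, F i x‖ₑ ^ 2
      = ∫⁻ x in Ω, ‖-(1 / (m : ℝ)) * D none x‖ₑ ^ 2 := by
    refine setLIntegral_congr_fun hΩ.measurableSet fun x hx => ?_
    simp only [← hu0]
    simp only [hFa _ x (hsub hx)]
  have hj : ∀ j : Fin d, ∫⁻ x in Ω, ‖lineDeriv ℝ (fun x => μ none x
        - (1 / (m : ℝ)) * ∑ i, F i x) x (EuclideanSpace.single j 1)‖ₑ ^ 2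
      = ∫⁻ x in Ω, ‖-(1 / (m : ℝ)) * D (some j) x‖ₑ ^ 2 := by
    intro j
    -- Rademacher's theorem makes the networks differentiable almost everywhere; near interior
    -- points they coincide with the ridge functions, which fixes the value of the derivative.
    have hdiff : ∀ᵐ x ∂volume.restrict Ω, ∀ i,
        LineDifferentiableAt ℝ (F i) x (EuclideanSpace.single j 1) := by
      refine ae_all_iff.2 fun i => ae_restrict_of_ae ?_
      obtain ⟨K, hK⟩ := hF i
      exact hK.ae_lineDifferentiableAt _
    refine lintegral_congr_ae ?_
    filter_upwards [hdiff, ae_mem_interior_cube hΩ.measurableSet hsub] with x hx hxi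
    have hFi : ∀ i, HasLineDerivAt ℝ (F i) (ridge A τ (some j) (a i) x) x
        (EuclideanSpace.single j 1) := fun i => by
      have hev : F i =ᶠ[nhds x] ridge A τ none (a i) := by
        filter_upwards [mem_interior_iff_mem_nhds.1 hxi] with y hy using hFa i y hy
      rw [← lineDeriv_ridge, ← hev.lineDeriv_eq]
      exact (hx i).hasLineDerivAt
    have hder : HasLineDerivAt ℝ (fun x => μ none x - (1 / (m : ℝ)) * ∑ i, F i x)
        (μ (some j) x - (1 / (m : ℝ)) * ∑ i, ridge A τ (some j) (a i) x) x
        (EuclideanSpace.single j 1) := by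
      have h1 := hasLineDerivAt_integral_ridge ρ hA hτ hA0 hAB x j
      unfold HasLineDerivAt at h1 hFi ⊢
      exact h1.sub ((HasDerivAt.fun_sum fun i _ => hFi i).const_mul _)
    rw [hder.lineDeriv]
    congr 2
    simp only [hD, Finset.sum_sub_distrib, Finset.sum_const, Finset.card_univ, Fintype.card_fin,
      nsmul_eq_mul]
    field_simp
    ring
  rw [h0, Finset.sum_congr rfl fun j _ => hj j, Finset.sum_congr rfl fun j _ => hL (some j), hL,
    ← ENNReal.ofReal_sum_of_nonneg, ← ENNReal.ofReal_add, Finset.mul_sum, Fintype.sum_option]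
  · positivity
  · positivity
  · intro j _
    positivity

/-- Simultaneous control of the `H¹` error and of the total depth of an average of networks that
approximates a mixture of ridge functions. -/
theorem exists_networks_of_mixture (ρ : Measure (Space d)) [IsProbabilityMeasure ρ]
    (hA : Measurable A) (hτ : Measurable τ) (hτ1 : ∀ ξ, |τ ξ| ≤ 1 / 2) (hA0 : ∀ ξ, 0 ≤ A ξ)
    (hAB : ∀ ξ, A ξ * (1 + norm1 ξ) ≤ B) (hB : 0 < B)
    (hlog : Integrable (fun ξ => Real.logb 2 (2 + norm1 ξ)) ρ)
    {Ω : Set (Space d)} (hΩ : IsCompact Ω) (hsub : Ω ⊆ cube d) {m : ℕ} (hm : 1 ≤ m) :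
    ∃ (L : Fin m → ℕ) (F : Fin m → Space d → ℝ), (∀ i, IsReLUNetwork 3 (L i) (F i)) ∧
      h1NormSq Ω (fun x => (∫ ξ, A ξ * Real.cos (2 * Real.pi * (inner ℝ ξ x + τ ξ)) ∂ρ)
          - (1 / (m : ℝ)) * ∑ i, F i x)
        ≤ ENNReal.ofReal (20 * Real.pi ^ 2 * B ^ 2 / m) * volume Ω ∧
      ∑ i, (L i : ℝ) ≤ 5 * m * ∫ ξ, Real.logb 2 (2 + norm1 ξ) ∂ρ := by
  have hm0 : (0 : ℝ) < m := by exact_mod_cast hm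
  have : IsFiniteMeasure (volume.restrict Ω) := ⟨by simpa using hΩ.measure_lt_top⟩
  set E := ∫ ξ, Real.logb 2 (2 + norm1 ξ) ∂ρ with hE
  have hE1 : 1 ≤ E := by
    have := integral_mono (integrable_const (1 : ℝ)) hlog one_le_logb_two_add_norm1
    simpa using this
  set V : ℝ := volume.real Ω with hV
  -- The value `1` for a null set keeps `C` positive, so that it can be cancelled in the depth
  -- bound; the error is then zero anyway.
  set C : ℝ := if V = 0 then 1 else (2 * Real.pi * B) ^ 2 * V with hCdef
  have hCpos : 0 < C := by
    by_cases h : V = 0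
    · simp [hCdef, h]
    · have : 0 < V := lt_of_le_of_ne measureReal_nonneg (Ne.symm h)
      rw [hCdef, if_neg h]
      positivity
  have hCle : (2 * Real.pi * B) ^ 2 * V ≤ C := by
    by_cases h : V = 0
    · simp [hCdef, h]
    · rw [hCdef, if_neg h]
  have hC : ∀ s, ∑ j, ∫ x in Ω, ridge A τ j s x ^ 2 ≤ C := fun s => by
    have hi : ∀ j, Integrable (fun x => ridge A τ j s x ^ 2) (volume.restrict Ω) := fun j => by
      refine integrable_of_measurable_of_abs_le
        (((measurable_ridge hA hτ j).comp measurable_prodMk_left).pow_const 2)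
        (K := (2 * Real.pi * B) ^ 2) fun x => ?_
      rw [abs_pow]
      exact pow_le_pow_left₀ (abs_nonneg _) (ridge_bound hA0 hAB j s x) 2
    rw [← integral_finsetSum _ fun j _ => hi j]
    refine le_trans (integral_mono (integrable_finsetSum _ fun j _ => hi j)
      (integrable_const ((2 * Real.pi * B) ^ 2)) fun x => sum_ridge_sq_le hA0 hAB s x) ?_
    simpa [hV, mul_comm] using hCle
  -- The weight `C / E` gives the depth cost mean `4C`. With the variance bound `C` this makes `5C`
  -- per sample, which is the source of both the `5` in the depth bound and the `20 = 5 * 4` in the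
  -- error.
  have hg : Integrable (fun s : Space d × ℝ => C / E * (4 * Real.logb 2 (2 + norm1 s.1)))
      (ρ.prod sineMeasure) :=
    ((hlog.comp_fst sineMeasure).const_mul 4).const_mul _
  have hgint : ∫ s : Space d × ℝ, C / E * (4 * Real.logb 2 (2 + norm1 s.1)) ∂ρ.prod sineMeasure
      = 4 * C := by
    rw [integral_const_mul, integral_const_mul,
      integral_fun_fst (fun ξ => Real.logb 2 (2 + norm1 ξ)), probReal_univ, one_smul, ← hE]
    field_simp
  obtain ⟨a, ha⟩ := exists_samples (ρ.prod sineMeasure) (volume.restrict Ω)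
    (U := ridge A τ) (measurable_ridge hA hτ) (ridge_bound hA0 hAB) hC hg m
  choose L F hF hLlog hFa using fun i => exists_network_on_cube (a i).1 (hτ1 (a i).1) (A (a i).1)
    (a i).2
  rw [hgint, ← Finset.mul_sum] at ha
  set Q := ∑ j, ∫ x in Ω,
    (∑ i, (ridge A τ j (a i) x - ∫ s, ridge A τ j s x ∂ρ.prod sineMeasure)) ^ 2 with hQ
  have hQ0 : 0 ≤ Q := Finset.sum_nonneg fun j _ => integral_nonneg fun x => sq_nonneg _
  set G := ∑ i, 4 * Real.logb 2 (2 + norm1 (a i).1) with hG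
  have hG0 : 0 ≤ G := Finset.sum_nonneg fun i _ => by linarith [one_le_logb_two_add_norm1 (a i).1]
  have hQ5 : Q ≤ m * (5 * C) := by
    have : 0 ≤ C / E * G := by positivity
    linarith
  refine ⟨L, F, hF, ?_, ?_⟩
  · simp only [← integral_ridge ρ hA hτ hA0 hAB]
    refine (h1NormSq_average_le ρ hA hτ hA0 hAB hΩ hsub hm a
      (fun i => (hF i).exists_lipschitzWith) hFa).trans ?_
    rw [← hQ]
    have hVe : volume Ω = ENNReal.ofReal V := (ofReal_measureReal hΩ.measure_lt_top.ne).symm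
    rw [hVe, ← ENNReal.ofReal_mul (by positivity)]
    refine ENNReal.ofReal_le_ofReal ?_
    by_cases h : V = 0
    · have hΩ0 : volume.restrict Ω = 0 := by
        rw [Measure.restrict_eq_zero, hVe, h, ENNReal.ofReal_zero]
      have : Q = 0 := by simp [hQ, hΩ0]
      rw [this, h]
      simp
    · calc (1 / (m : ℝ)) ^ 2 * Q ≤ (1 / (m : ℝ)) ^ 2 * (m * (5 * C)) := by gcongr
        _ = _ := by
          rw [hCdef, if_neg h]
          field_simp
          ring
  · have h1 : ∑ i, (L i : ℝ) ≤ G := Finset.sum_le_sum fun i _ => hLlog i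
    have h2 : C / E * G ≤ m * (5 * C) := by linarith
    rw [div_mul_eq_mul_div, div_le_iff₀ (by linarith)] at h2
    have h3 : G ≤ 5 * m * E := by
      refine le_of_mul_le_mul_left ?_ hCpos
      linarith
    exact h1.trans h3

end Mixture

/-! ### The approximation theorem -/

section Main

variable {d : ℕ}

lemma barronNorm_one_eq {T : 𝓢'(Space d, ℂ)} {h : Space d → ℂ} (H : IsRepresentedBy (𝓕 T) h) :
    barronNorm 1 T = ∫⁻ ξ, ENNReal.ofReal (1 + norm1 ξ) * ‖h ξ‖ₑ := by
  rw [barronNorm, fourierWeightNorm_eq _ H]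
  simp only [Real.rpow_one]

lemma logBarronNorm_one_eq {T : 𝓢'(Space d, ℂ)} {h : Space d → ℂ}
    (H : IsRepresentedBy (𝓕 T) h) :
    logBarronNorm 1 T = ∫⁻ ξ, ENNReal.ofReal (Real.logb 2 (2 + norm1 ξ)) *
      (ENNReal.ofReal (1 + norm1 ξ) * ‖h ξ‖ₑ) := by
  rw [logBarronNorm, fourierWeightNorm_eq _ H]
  refine lintegral_congr fun ξ => ?_
  rw [Real.rpow_one, mul_comm (1 + norm1 ξ),
    ENNReal.ofReal_mul (by linarith [one_le_logb_two_add_norm1 ξ]), mul_assoc]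

lemma barronNorm_le_logBarronNorm {T : 𝓢'(Space d, ℂ)} {h : Space d → ℂ}
    (H : IsRepresentedBy (𝓕 T) h) : barronNorm 1 T ≤ logBarronNorm 1 T := by
  rw [barronNorm_one_eq H, logBarronNorm_one_eq H]
  refine lintegral_mono fun ξ => le_mul_of_one_le_left zero_le ?_
  exact ENNReal.one_le_ofReal.2 (one_le_logb_two_add_norm1 ξ)

lemma integrable_of_barronNorm_lt_top {T : 𝓢'(Space d, ℂ)} {h : Space d → ℂ} (hm : Measurable h)
    (H : IsRepresentedBy (𝓕 T) h) (hT : barronNorm 1 T < ⊤) : Integrable h := by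
  refine ⟨hm.aestronglyMeasurable, lt_of_le_of_lt (lintegral_mono fun ξ => ?_)
    (barronNorm_one_eq H ▸ hT)⟩
  refine le_mul_of_one_le_left zero_le (ENNReal.one_le_ofReal.2 ?_)
  linarith [norm1_nonneg ξ]

/-- The frequency distribution of a Barron function, proportional to `(1 + |ξ|₁) |h ξ|`. -/
noncomputable def frequencyMeasure (h : Space d → ℂ) : Measure (Space d) :=
  (∫⁻ ξ, ENNReal.ofReal (1 + norm1 ξ) * ‖h ξ‖ₑ)⁻¹ •
    volume.withDensity fun ξ => ENNReal.ofReal (1 + norm1 ξ) * ‖h ξ‖ₑ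

lemma measurable_frequencyDensity {h : Space d → ℂ} (hm : Measurable h) :
    Measurable fun ξ => ENNReal.ofReal (1 + norm1 ξ) * ‖h ξ‖ₑ := by
  have := measurable_norm1 (d := d)
  fun_prop

lemma isProbabilityMeasure_frequencyMeasure {h : Space d → ℂ}
    (h0 : ∫⁻ ξ, ENNReal.ofReal (1 + norm1 ξ) * ‖h ξ‖ₑ ≠ 0)
    (h1 : ∫⁻ ξ, ENNReal.ofReal (1 + norm1 ξ) * ‖h ξ‖ₑ ≠ ⊤) :
    IsProbabilityMeasure (frequencyMeasure h) := by
  refine ⟨?_⟩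
  rw [frequencyMeasure, Measure.smul_apply, withDensity_apply _ MeasurableSet.univ,
    Measure.restrict_univ, smul_eq_mul, ENNReal.inv_mul_cancel h0 h1]

lemma integral_frequencyMeasure {h : Space d → ℂ} (hm : Measurable h) (g : Space d → ℝ) :
    ∫ ξ, g ξ ∂frequencyMeasure h
      = (∫⁻ ξ, ENNReal.ofReal (1 + norm1 ξ) * ‖h ξ‖ₑ).toReal⁻¹ *
        ∫ ξ, (1 + norm1 ξ) * ‖h ξ‖ * g ξ := by
  rw [frequencyMeasure, integral_smul_measure,
    integral_withDensity_eq_integral_toReal_smul (measurable_frequencyDensity hm)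
      (Filter.Eventually.of_forall fun ξ => ENNReal.mul_lt_top ENNReal.ofReal_lt_top
        enorm_lt_top), ENNReal.toReal_inv, smul_eq_mul]
  congr 1
  refine integral_congr_ae (Filter.Eventually.of_forall fun ξ => ?_)
  simp only [ENNReal.toReal_mul, toReal_enorm, smul_eq_mul]
  rw [ENNReal.toReal_ofReal (by linarith [norm1_nonneg ξ])]

/-- The log-Barron weight is the Barron weight times the logarithm, so the mean depth cost is
exactly the ratio in the theorem. -/
lemma lintegral_logb_frequencyMeasure {T : 𝓢'(Space d, ℂ)} {h : Space d → ℂ} (hm : Measurable h)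
    (H : IsRepresentedBy (𝓕 T) h) :
    ∫⁻ ξ, ENNReal.ofReal (Real.logb 2 (2 + norm1 ξ)) ∂frequencyMeasure h
      = logBarronNorm 1 T / barronNorm 1 T := by
  rw [frequencyMeasure, lintegral_smul_measure, lintegral_withDensity_eq_lintegral_mul₀
    (measurable_frequencyDensity hm).aemeasurable, logBarronNorm_one_eq H, barronNorm_one_eq H,
    ENNReal.div_eq_inv_mul, smul_eq_mul]
  · simp only [Pi.mul_apply, mul_comm]
  · have := measurable_norm1 (d := d)
    unfold Real.logb
    fun_prop

lemma isReLUNetwork_zero (N : ℕ) : IsReLUNetwork N 1 (fun _ : Space d => 0) :=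
  ⟨le_rfl, 0, 0, 0, 0, fun x => by simp⟩

lemma h1NormSq_zero (Ω : Set (Space d)) : h1NormSq Ω (fun _ => 0) = 0 := by
  refine le_antisymm ((h1NormSq_le_of_lipschitzWith Ω (LipschitzWith.const 0)).trans ?_) zero_le
  simp [lineDeriv]

end Main

end LogBarron

theorem mainTheorem6 (d : ℕ) (T : 𝓢'(LogBarron.Space d, ℂ)) (hreal : LogBarron.IsReal T)
    (hT : T ∈ LogBarron.logBarronSpace d 1) :
    ∃ f : LogBarron.Space d → ℝ,
      Continuous f ∧ LogBarron.IsRepresentedBy T (fun x => (f x : ℂ)) ∧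
      ∀ (m : ℕ), 1 ≤ m → ∀ Ω : Set (LogBarron.Space d), IsCompact Ω →
        Ω ⊆ {x | ∀ i, x i ∈ Set.Icc (0 : ℝ) 1} →
        ∃ (L : Fin m → ℕ) (F : Fin m → LogBarron.Space d → ℝ),
          (∀ i, LogBarron.IsReLUNetwork 3 (L i) (F i)) ∧
          LogBarron.h1NormSq Ω (fun x => f x - (1 / (m : ℝ)) * ∑ i, F i x)
            ≤ ENNReal.ofReal (11 * Real.pi ^ 4 / m) * volume Ω * LogBarron.barronNorm 1 T ^ 2 ∧
          (T ≠ 0 → ((∑ i, L i : ℕ) : ℝ≥0∞)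
            ≤ 5 * m * (LogBarron.logBarronNorm 1 T / LogBarron.barronNorm 1 T)) := by

  obtain ⟨h, hm, H⟩ := LogBarron.exists_measurable_isRepresentedBy hT
  have hlogtop : LogBarron.logBarronNorm 1 T ≠ ⊤ := ne_of_lt hT
  have hBtop : LogBarron.barronNorm 1 T < ⊤ :=
    (LogBarron.barronNorm_le_logBarronNorm H).trans_lt hT
  have hi := LogBarron.integrable_of_barronNorm_lt_top hm H hBtop
  set f : LogBarron.Space d → ℝ := fun x => ∫ ξ, ‖h ξ‖ *
    Real.cos (2 * Real.pi * (inner ℝ ξ x + Complex.arg (h ξ) / (2 * Real.pi))) with hf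
  obtain ⟨hfc, hfT⟩ := hreal.isRepresentedBy_integral_cos H hi (f := f) fun _ => rfl
  refine ⟨f, hfc, hfT, fun m hm1 Ω hΩ hsub => ?_⟩
  have hnorm := LogBarron.barronNorm_one_eq H
  -- With zero norm there is no frequency distribution to sample from; then `h`, `f` and `T` vanish
  -- and zero networks suffice.
  by_cases hB0 : LogBarron.barronNorm 1 T = 0
  · have hh : h =ᵐ[volume] 0 := by
      have h0 := (lintegral_eq_zero_iff (LogBarron.measurable_frequencyDensity hm)).1
        (hnorm.symm.trans hB0)
      refine h0.mono fun ξ hξ => ?_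
      rcases mul_eq_zero.1 hξ with h1 | h1
      · rw [ENNReal.ofReal_eq_zero] at h1
        linarith [LogBarron.norm1_nonneg ξ]
      · exact enorm_eq_zero.1 h1
    have hf0 : ∀ x, f x = 0 := fun x => by
      refine integral_eq_zero_of_ae (hh.mono fun ξ hξ => ?_)
      simp [hξ]
    refine ⟨fun _ => 1, fun _ _ => 0, fun _ => LogBarron.isReLUNetwork_zero 3, ?_, fun hT0 => ?_⟩
    · simp only [hf0, Finset.sum_const_zero, mul_zero, sub_zero, LogBarron.h1NormSq_zero]
      exact zero_le
    · refine absurd ?_ hT0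
      ext φ
      rw [(hfT.2 φ).2]
      simp [hf0]
  · set B : ℝ := (LogBarron.barronNorm 1 T).toReal with hBdef
    have hBpos : 0 < B := ENNReal.toReal_pos hB0 hBtop.ne
    have hBe : LogBarron.barronNorm 1 T = ENNReal.ofReal B := (ENNReal.ofReal_toReal hBtop.ne).symm
    have hprob := LogBarron.isProbabilityMeasure_frequencyMeasure (hnorm ▸ hB0) (hnorm ▸ hBtop.ne)
    have hw : ∀ ξ : LogBarron.Space d, 0 < 1 + LogBarron.norm1 ξ := fun ξ => by
      linarith [LogBarron.norm1_nonneg ξ]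
    have hn1 := LogBarron.measurable_norm1 (d := d)
    have hlin := LogBarron.lintegral_logb_frequencyMeasure hm H
    have hratio : LogBarron.logBarronNorm 1 T / LogBarron.barronNorm 1 T ≠ ⊤ :=
      ENNReal.div_ne_top hlogtop hB0
    have hlogm : Measurable fun ξ : LogBarron.Space d => Real.logb 2 (2 + LogBarron.norm1 ξ) := by
      unfold Real.logb
      fun_prop
    have hlog0 : ∀ ξ : LogBarron.Space d, 0 ≤ Real.logb 2 (2 + LogBarron.norm1 ξ) := fun ξ => by
      linarith [LogBarron.one_le_logb_two_add_norm1 ξ]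
    have hlog : Integrable (fun ξ => Real.logb 2 (2 + LogBarron.norm1 ξ))
        (LogBarron.frequencyMeasure h) := by
      refine ⟨hlogm.aestronglyMeasurable, ?_⟩
      rw [hasFiniteIntegral_iff_ofReal (Filter.Eventually.of_forall hlog0), hlin]
      exact hratio.lt_top
    have hAB : ∀ ξ : LogBarron.Space d,
        B / (1 + LogBarron.norm1 ξ) * (1 + LogBarron.norm1 ξ) ≤ B := fun ξ =>
      (div_mul_cancel₀ _ (hw ξ).ne').le
    have hτ1 : ∀ ξ, |Complex.arg (h ξ) / (2 * Real.pi)| ≤ 1 / 2 := fun ξ => by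
      rw [abs_div, abs_of_pos (by positivity : 0 < 2 * Real.pi), div_le_iff₀ (by positivity)]
      linarith [Complex.abs_arg_le_pi (h ξ)]
    obtain ⟨L, F, hF, herr, hdepth⟩ := LogBarron.exists_networks_of_mixture
      (A := fun ξ => B / (1 + LogBarron.norm1 ξ))
      (τ := fun ξ => Complex.arg (h ξ) / (2 * Real.pi)) (LogBarron.frequencyMeasure h)
      (by fun_prop) (by fun_prop) hτ1 (fun ξ => (div_pos hBpos (hw ξ)).le) hAB hBpos hlog hΩ hsub
      hm1
    -- The density `B⁻¹ (1 + |ξ|₁) ‖h ξ‖` times the amplitude `B / (1 + |ξ|₁)` is `‖h ξ‖`.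
    have hfe : ∀ x, ∫ ξ, B / (1 + LogBarron.norm1 ξ) * Real.cos (2 * Real.pi *
        (inner ℝ ξ x + Complex.arg (h ξ) / (2 * Real.pi))) ∂LogBarron.frequencyMeasure h
        = f x := fun x => by
      rw [LogBarron.integral_frequencyMeasure hm, ← hnorm, ← hBdef, ← integral_const_mul]
      refine integral_congr_ae (Filter.Eventually.of_forall fun ξ => ?_)
      have := (hw ξ).ne'
      simp only
      field_simp
    simp only [hfe] at herr
    refine ⟨L, F, hF, herr.trans ?_, fun _ => ?_⟩
    · rw [hBe, mul_right_comm _ (volume Ω), ← ENNReal.ofReal_pow hBpos.le,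
        ← ENNReal.ofReal_mul (by positivity)]
      have hpi : 20 ≤ 11 * Real.pi ^ 2 := by nlinarith [Real.pi_gt_three]
      have hle : 20 * Real.pi ^ 2 * B ^ 2 ≤ 11 * Real.pi ^ 4 * B ^ 2 := by
        nlinarith [mul_le_mul_of_nonneg_right hpi (by positivity : 0 ≤ Real.pi ^ 2 * B ^ 2)]
      rw [div_mul_eq_mul_div]
      exact mul_le_mul_left (ENNReal.ofReal_le_ofReal (div_le_div_of_nonneg_right hle
        (by positivity))) _
    · have h1 := ENNReal.ofReal_le_ofReal hdepth
      rw [← hlin, ← ofReal_integral_eq_lintegral_ofReal hlog (Filter.Eventually.of_forall hlog0)]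
      refine le_trans (le_of_eq ?_) (h1.trans (le_of_eq ?_))
      · rw [← Nat.cast_sum, ENNReal.ofReal_natCast]
      · rw [ENNReal.ofReal_mul (by positivity), ENNReal.ofReal_mul (by norm_num),
          ENNReal.ofReal_natCast, ENNReal.ofReal_ofNat, mul_assoc]
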